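/- For $m,n\in\mathbb N=\{0,1,2,\dots\}$ let $\mathcal B_{mn}$ be the set of all Brauer partitions of $[m]\cup[n]'$, i.e. set partitions of $\{1,\dots,m\}\cup\{1',\dots,n'\}$ all of whose blocks have size $2$. For $\alpha\in\mathcal B_{mn}$ and $\beta\in\mathcal B_{nk}$, the product $\alpha\beta\in\mathcal B_{mk}$ is obtained by identifying the lower vertices of $\alpha$ with the upper vertices of $\beta$: two of the remaining vertices lie in the same block of $\alpha\beta$ if and only if they lie in the same connected component of the resulting graph. The rank of a partition is the number of its transversals, i.e. of the blocks containing both an unprimed and a primed vertex. For $\sigma\in\mathcal B_{nm}$, the sandwich semigroup $\mathcal B_{mn}^\sigma$ is the set $\mathcal B_{mn}$ with the associative operation $\alpha\star_\sigma\beta=\alpha\sigma\beta$. For $q\in\mathbb N$ let $D_q^\sigma$ be the set of all (von Neumann) regular elements of $\mathcal B_{mn}^\sigma$ of rank $q$. Double factorials are taken with the convention $(-1)!!=1$. **Theorem.** Let $m,n\in\mathbb N$, let $\sigma\in\mathcal B_{nm}$, and let $r=\operatorname{rank}\sigma$. The number of idempotents of the sandwich semigroup $\mathcal B_{mn}^\sigma$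 is $$e(\mathcal B_{mn}^\sigma)=\sum_{\substack{0\le q\le r\\ q\equiv r\ (\mathrm{mod}\ 2)}}\binom rq\,\frac{(r-q-1)!!\,(m+q-1)!!\,(n+q-1)!!}{(r+q-1)!!\,(2q-1)!!}.$$ Moreover, for each $0\le q\le r$ with $q\equiv r\pmod 2$, the $q$th term of this sum is the number of idempotents belonging to $D_q^\sigma$. -/

import Mathlib

namespace Diagram

section SetoidFacts

variable {V W U : Type*}

theorem map_le_iff (f : V → W) (r : Setoid V) (s : Setoid W) :
    r.map f ≤ s ↔ r ≤ s.comap f := by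
  constructor
  · intro h x y hxy
    exact h (Relation.EqvGen.rel _ _ ⟨x, y, hxy, rfl, rfl⟩)
  · intro h
    refine Setoid.eqvGen_le ?_
    rintro _ _ ⟨x, y, hxy, rfl, rfl⟩
    exact h hxy

theorem map_map (f : V → W) (g : W → U) (r : Setoid V) : (r.map f).map g = r.map (g ∘ f) := by
  refine eq_of_forall_ge_iff fun s => ?_
  rw [map_le_iff, map_le_iff, map_le_iff, Setoid.comap_comp]

theorem map_sup (f : V → W) (r s : Setoid V) : (r ⊔ s).map f = r.map f ⊔ s.map f := by
  refine eq_of_forall_ge_iff fun t => ?_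
  rw [map_le_iff, sup_le_iff, sup_le_iff, map_le_iff, map_le_iff]

theorem map_rel_iff {f : V → W} (hf : Function.Injective f) (r : Setoid V) (u v : W) :
    r.map f u v ↔ (∃ x y, r x y ∧ f x = u ∧ f y = v) ∨ u = v := by
  have h : Setoid.ker f ≤ r := by
    intro x y hxy
    rw [hf hxy]
  rw [Setoid.coe_map_of_ker_le r f h]
  rfl

/-- Attaching edges along the image of `f` and then restricting to that image. -/
theorem comap_sup_map (f : W → V) (a : Setoid V) (c : Setoid W) :
    (a ⊔ c.map f).comap f = a.comap f ⊔ c := by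
  apply le_antisymm
  · let e : Setoid W := a.comap f ⊔ c
    have hae : ∀ {p q : W}, a (f p) (f q) → e p q := fun {p q} h =>
      (le_sup_left : a.comap f ≤ e) h
    let s : Setoid V :=
      { r := fun u v => a u v ∨ ∃ p q, a u (f p) ∧ a v (f q) ∧ e p q
        iseqv := by
          refine ⟨fun u => Or.inl (a.refl' u), ?_, ?_⟩
          · rintro u v (h | ⟨p, q, h1, h2, h3⟩)
            · exact Or.inl (a.symm' h)
            · exact Or.inr ⟨q, p, h2, h1, e.symm' h3⟩
          · rintro u v w (h | ⟨p, q, h1, h2, h3⟩) (h' | ⟨p', q', h1', h2', h3'⟩)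
            · exact Or.inl (a.trans' h h')
            · exact Or.inr ⟨p', q', a.trans' h h1', h2', h3'⟩
            · exact Or.inr ⟨p, q, h1, a.trans' (a.symm' h') h2, h3⟩
            · exact Or.inr ⟨p, q', h1, h2',
                e.trans' h3 (e.trans' (hae (a.trans' (a.symm' h2) h1')) h3')⟩ }
    have hs : a ⊔ c.map f ≤ s := by
      refine sup_le (fun {u v} h => Or.inl h) ?_
      rw [map_le_iff]
      intro p q h
      exact Or.inr ⟨p, q, a.refl' _, a.refl' _, (le_sup_right : c ≤ e) h⟩
    intro u v h
    rcases hs h with h | ⟨p, q, h1, h2, h3⟩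
    · exact hae h
    · exact e.trans' (hae h1) (e.trans' h3 (e.symm' (hae h2)))
  · refine sup_le (fun {u v} h => (le_sup_left : a ≤ a ⊔ c.map f) h) ?_
    rw [← map_le_iff]
    exact le_sup_right

theorem comap_map_of_pullback {X : Type*} {e : V → X} {e' : W → X} {o : U → V} {i : U → W}
    (he : Function.Injective e) (he' : Function.Injective e') (hc : ∀ z, e (o z) = e' (i z))
    (hp : ∀ x y, e x = e' y → ∃ z, o z = x ∧ i z = y) (p : Setoid V) :
    (p.map e).comap e' = (p.comap o).map i := by
  apply le_antisymm
  · intro u v h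
    rcases (map_rel_iff he p _ _).1 h with ⟨x, y, hxy, hx, hy⟩ | h
    · obtain ⟨z, rfl, rfl⟩ := hp _ _ hx
      obtain ⟨w, rfl, rfl⟩ := hp _ _ hy
      exact Relation.EqvGen.rel _ _ ⟨z, w, hxy, rfl, rfl⟩
    · rw [he' h]
  · rw [map_le_iff]
    intro z w h
    change p.map e (e' (i z)) (e' (i w))
    rw [← hc, ← hc]
    exact Relation.EqvGen.rel _ _ ⟨_, _, h, rfl, rfl⟩

/-- An equivalence whose classes have at most two elements is given by an involution. -/
theorem exists_involution [Finite V] (r : Setoid V) (h : ∀ x, {y | r x y}.ncard ≤ 2) :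
    ∃ a : V → V, (∀ x, a (a x) = x) ∧ ∀ x y, r x y ↔ y = x ∨ y = a x := by
  have h1 : ∀ x, ∃ z, ∀ y, r x y ↔ y = x ∨ y = z := by
    intro x
    by_cases hz : ∃ z, r x z ∧ z ≠ x
    · obtain ⟨z, hz, hzx⟩ := hz
      refine ⟨z, fun y => ⟨fun hy => ?_, ?_⟩⟩
      · by_contra! hne
        have hsub : ({x, z, y} : Set V) ⊆ {y | r x y} := by
          rintro w (rfl | rfl | rfl)
          · exact r.refl' _
          · exact hz
          · exact hy
        have h3 : ({x, z, y} : Set V).ncard = 3 := by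
          rw [Set.ncard_eq_three]
          exact ⟨x, z, y, hzx.symm, hne.1.symm, hne.2.symm, rfl⟩
        have := Set.ncard_le_ncard hsub (Set.toFinite _)
        have := h x
        omega
      · rintro (rfl | rfl)
        · exact r.refl' _
        · exact hz
    · push Not at hz
      refine ⟨x, fun y => ⟨fun hy => Or.inl (hz y hy), ?_⟩⟩
      rintro (rfl | rfl) <;> exact r.refl' _
  choose a ha using h1
  refine ⟨a, fun x => ?_, ha⟩
  have hxa : r x (a x) := (ha x _).2 (Or.inr rfl)
  have h2 : r x (a (a x)) := r.trans' hxa ((ha _ _).2 (Or.inr rfl))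
  rcases (ha (a x) x).1 (r.symm' hxa) with h | h
  · rw [← h]
    exact h.symm
  · exact h.symm

/-- A component of the union of two graphs of involutions which contains a point fixed by the
first but not by the second is a path, hence contains exactly two points fixed by one of them. -/
theorem ncard_fixed_of_involutions [Finite V] (a b : V → V) (ha : ∀ x, a (a x) = x)
    (hb : ∀ x, b (b x) = x) (s : Setoid V) (hsa : ∀ x, s x (a x)) (hsb : ∀ x, s x (b x))
    (hs : ∀ t : Setoid V, (∀ x, t x (a x)) → (∀ x, t x (b x)) → s ≤ t)
    (x : V) (hax : a x = x) (hbx : b x ≠ x) :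
    {y | s x y ∧ (a y = y ∨ b y = y)}.ncard = 2 := by
  let t : Equiv.Perm V := ⟨fun v => a (b v), fun v => b (a v), fun v => by simp [ha, hb],
    fun v => by simp [ha, hb]⟩
  have hta : ∀ v, a (t v) = t⁻¹ (a v) := fun v => by
    change a (a (b v)) = b (a (a v))
    rw [ha, ha]
  have htb : ∀ v, b v = a (t v) := fun v => (ha _).symm
  have hzero : ∀ i : ℤ, a ((t ^ i) x) = (t ^ (-i)) x := by
    have hn : ∀ (n : ℕ) (v : V), a ((t ^ n) v) = (t⁻¹ ^ n) (a v) := by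
      intro n
      induction n with
      | zero => intro v; rfl
      | succ n ih =>
        intro v
        rw [pow_succ, Equiv.Perm.mul_apply, ih, hta, pow_succ, Equiv.Perm.mul_apply]
    intro i
    obtain ⟨n, rfl | rfl⟩ := i.eq_nat_or_neg
    · have := hn n x
      rw [hax] at this
      simpa using this
    · have h := hn n ((t⁻¹ ^ n) x)
      have h1 : (t ^ n) ((t⁻¹ ^ n) x) = x := by simp
      rw [h1, hax] at h
      have h2 : (t ^ n) x = a ((t⁻¹ ^ n) x) := by
        conv_lhs => rw [h]
        simp
      simpa using h2.symm
  have hbi : ∀ i : ℤ, b ((t ^ i) x) = (t ^ (-(i + 1))) x := by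
    intro i
    rw [htb, ← hzero (i + 1), add_comm, zpow_add, Equiv.Perm.mul_apply, zpow_one]
  -- the component of `x` is its cycle under `t`
  have hcomp : ∀ y, s x y ↔ ∃ i : ℤ, (t ^ i) x = y := by
    intro y
    constructor
    · intro h
      let c : Setoid V :=
        { r := fun u v => (∃ i : ℤ, (t ^ i) x = u) ↔ ∃ i : ℤ, (t ^ i) x = v
          iseqv := ⟨fun _ => Iff.rfl, fun h => h.symm, fun h h' => h.trans h'⟩ }
      have hca : ∀ u, (∃ i : ℤ, (t ^ i) x = u) → ∃ i : ℤ, (t ^ i) x = a u := by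
        rintro _ ⟨i, rfl⟩
        exact ⟨-i, (hzero i).symm⟩
      have hcb : ∀ u, (∃ i : ℤ, (t ^ i) x = u) → ∃ i : ℤ, (t ^ i) x = b u := by
        rintro _ ⟨i, rfl⟩
        exact ⟨-(i + 1), (hbi i).symm⟩
      have hle : s ≤ c := by
        refine hs c (fun u => ⟨hca u, fun h => ?_⟩) (fun u => ⟨hcb u, fun h => ?_⟩)
        · have := hca _ h
          rwa [ha] at this
        · have := hcb _ h
          rwa [hb] at this
      exact (hle h).1 ⟨0, rfl⟩
    · rintro ⟨i, rfl⟩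
      have hst : ∀ v, s v (t v) := fun v => s.trans' (hsb v) (hsa _)
      induction i with
      | zero => exact s.refl' _
      | succ i ih =>
        refine s.trans' ih ?_
        rw [add_comm, zpow_add, Equiv.Perm.mul_apply, zpow_one]
        exact hst _
      | pred i ih =>
        refine s.trans' ih (s.symm' ?_)
        have h := hst ((t ^ (-(i : ℤ) - 1)) x)
        rwa [← Equiv.Perm.mul_apply, ← zpow_one_add,
          show (1 : ℤ) + (-(i : ℤ) - 1) = -(i : ℤ) by ring] at h
  set L : ℕ := Function.minimalPeriod t x with hL
  have hfin : IsOfFinOrder t := isOfFinOrder_of_finite t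
  have hdvd : ∀ i : ℤ, (t ^ i) x = x ↔ (L : ℤ) ∣ i := by
    intro i
    exact MulAction.zpow_smul_eq_iff_minimalPeriod_dvd (a := t) (b := x) (n := i)
  have heq : ∀ i j : ℤ, (t ^ i) x = (t ^ j) x ↔ (L : ℤ) ∣ i - j := by
    intro i j
    rw [← hdvd, sub_eq_neg_add, zpow_add, Equiv.Perm.mul_apply, zpow_neg, Equiv.Perm.inv_eq_iff_eq]
  have hL0 : L ≠ 0 := by
    intro h0
    obtain ⟨n, hn, h1⟩ := hfin.exists_pow_eq_one
    have h2 := (hdvd n).1 (by rw [zpow_natCast, h1]; rfl)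
    rw [h0] at h2
    simp at h2
    omega
  have hL1 : L ≠ 1 := by
    intro h1
    apply hbx
    have h2 := hbi 0
    have h3 := (hdvd (-(0 + 1))).2 (by rw [h1]; simp)
    rw [h3] at h2
    exact h2
  have hset : {y | s x y ∧ (a y = y ∨ b y = y)} = {x, (t ^ ((L / 2 : ℕ) : ℤ)) x} := by
    ext y
    constructor
    · rintro ⟨hy, hf⟩
      obtain ⟨i₀, rfl⟩ := (hcomp y).1 hy
      obtain ⟨i, hi0, hiL, hi⟩ : ∃ i : ℤ, 0 ≤ i ∧ i < L ∧ (t ^ i₀) x = (t ^ i) x := by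
        refine ⟨i₀ % L, Int.emod_nonneg _ (by omega), Int.emod_lt_of_pos _ (by omega), ?_⟩
        rw [heq]
        exact Int.dvd_self_sub_emod
      rw [hi] at hf ⊢
      have hcase : i = 0 ∨ i = (L / 2 : ℕ) := by
        rcases hf with hf | hf
        · rw [hzero, heq] at hf
          obtain ⟨k, hk⟩ := hf
          have h1 : -2 < k := by nlinarith
          have h2 : k ≤ 0 := by nlinarith
          have : k = -1 ∨ k = 0 := by omega
          rcases this with rfl | rfl <;> omega
        · rw [hbi, heq] at hf
          obtain ⟨k, hk⟩ := hf
          have h1 : -2 < k := by nlinarith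
          have h2 : k < 0 := by nlinarith
          have : k = -1 := by omega
          subst this
          omega
      rcases hcase with rfl | rfl
      · exact Or.inl rfl
      · exact Or.inr rfl
    · rintro (rfl | rfl)
      · exact ⟨s.refl' _, Or.inl hax⟩
      · refine ⟨(hcomp _).2 ⟨_, rfl⟩, ?_⟩
        rw [hzero, hbi, heq, heq]
        rcases Nat.even_or_odd' L with ⟨k, hk | hk⟩
        · exact Or.inl ⟨-1, by omega⟩
        · exact Or.inr ⟨-1, by omega⟩
  rw [hset, Set.ncard_pair]
  intro h
  have h1 := (hdvd _).1 h.symm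
  have h2 := Int.le_of_dvd (by omega) h1
  omega

end SetoidFacts

/-- The set `𝒫_{mn}` of set partitions of `[m] ∪ [n]'`: the upper vertices are the `Sum.inl i`,
the lower vertices the `Sum.inr j`. -/
abbrev Partition (m n : ℕ) : Type := Setoid (Fin m ⊕ Fin n)

section Composition

variable {X Y Z W : Type*}

/-- The inclusion of the upper two of the three rows of vertices of a product graph. -/
def upperTwo : X ⊕ Y → X ⊕ (Y ⊕ Z) := Sum.map id Sum.inl

/-- The inclusion of the lower two of the three rows of vertices of a product graph. -/
def lowerTwo : Y ⊕ Z → X ⊕ (Y ⊕ Z) := Sum.inr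

/-- The inclusion of the top and bottom rows of vertices of a product graph. -/
def outerTwo : X ⊕ Z → X ⊕ (Y ⊕ Z) := Sum.map id Sum.inr

/-- The connected components of the product graph of `α` and `β`. -/
def productGraph (α : Setoid (X ⊕ Y)) (β : Setoid (Y ⊕ Z)) : Setoid (X ⊕ (Y ⊕ Z)) :=
  α.map upperTwo ⊔ β.map lowerTwo

/-- The product of partitions: two outer vertices are in the same block if and only if they are
in the same connected component of the product graph. -/
def comp (α : Setoid (X ⊕ Y)) (β : Setoid (Y ⊕ Z)) : Setoid (X ⊕ Z) :=
  (productGraph α β).comap outerTwo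

theorem comp_assoc (α : Setoid (X ⊕ Y)) (β : Setoid (Y ⊕ Z)) (γ : Setoid (Z ⊕ W)) :
    comp (comp α β) γ = comp α (comp β γ) := by
  let e₁ : X ⊕ (Y ⊕ Z) → X ⊕ (Y ⊕ (Z ⊕ W)) := Sum.map id (Sum.map id Sum.inl)
  let f₁ : X ⊕ (Z ⊕ W) → X ⊕ (Y ⊕ (Z ⊕ W)) := Sum.map id Sum.inr
  let e₂ : Y ⊕ (Z ⊕ W) → X ⊕ (Y ⊕ (Z ⊕ W)) := Sum.inr
  let f₂ : X ⊕ (Y ⊕ W) → X ⊕ (Y ⊕ (Z ⊕ W)) := Sum.map id (Sum.map id Sum.inr)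
  let t : Setoid (X ⊕ (Y ⊕ (Z ⊕ W))) :=
    α.map (Sum.map id Sum.inl) ⊔ β.map (Sum.inr ∘ Sum.map id Sum.inl) ⊔
      γ.map (Sum.inr ∘ Sum.inr)
  have he₁ : Function.Injective e₁ :=
    Sum.map_injective.2 ⟨Function.injective_id,
      Sum.map_injective.2 ⟨Function.injective_id, Sum.inl_injective⟩⟩
  have hf₁ : Function.Injective f₁ :=
    Sum.map_injective.2 ⟨Function.injective_id, Sum.inr_injective⟩
  have hf₂ : Function.Injective f₂ :=
    Sum.map_injective.2 ⟨Function.injective_id,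
      Sum.map_injective.2 ⟨Function.injective_id, Sum.inr_injective⟩⟩
  have h₁ : t.comap f₁ = productGraph (comp α β) γ := by
    have ht : t = (productGraph α β).map e₁ ⊔ (γ.map lowerTwo).map f₁ := by
      have h : (Sum.map id Sum.inl : X ⊕ Y → X ⊕ (Y ⊕ (Z ⊕ W))) = e₁ ∘ upperTwo := by
        funext v
        rcases v with v | v <;> rfl
      rw [productGraph, map_sup, map_map, map_map, map_map, ← h]
      rfl
    rw [ht, comap_sup_map, productGraph, comp]
    congr 1
    refine comap_map_of_pullback he₁ hf₁ ?_ ?_ _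
    · rintro (v | v) <;> rfl
    · rintro (x | y | z) (x' | z' | w') h <;> simp [e₁, f₁] at h
      · exact ⟨Sum.inl x, rfl, by rw [h]; rfl⟩
      · exact ⟨Sum.inr z, rfl, by rw [h]; rfl⟩
  have h₂ : t.comap f₂ = productGraph α (comp β γ) := by
    have ht : t = (productGraph β γ).map e₂ ⊔ (α.map upperTwo).map f₂ := by
      have h : (Sum.map id Sum.inl : X ⊕ Y → X ⊕ (Y ⊕ (Z ⊕ W))) = f₂ ∘ upperTwo := by
        funext v
        rcases v with v | v <;> rfl
      rw [productGraph, map_sup, map_map, map_map, map_map, sup_comm, ← sup_assoc, ← h]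
      rfl
    rw [ht, comap_sup_map, sup_comm, productGraph, comp]
    congr 1
    refine comap_map_of_pullback Sum.inr_injective hf₂ ?_ ?_ _
    · rintro (v | v) <;> rfl
    · rintro (y | z | w) (x' | y' | w') h <;> simp [f₂] at h
      · exact ⟨Sum.inl y, rfl, by rw [h]; rfl⟩
      · exact ⟨Sum.inr w, rfl, by rw [h]; rfl⟩
  rw [comp, ← h₁, comp, ← h₂, ← Setoid.comap_comp, ← Setoid.comap_comp]
  congr 1
  funext v
  rcases v with v | v <;> rfl

/-- Every block has size `2`. -/
def IsBrauer {V : Type*} (r : Setoid V) : Prop := ∀ B ∈ r.classes, B.ncard = 2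

theorem isBrauer_iff {V : Type*} (r : Setoid V) : IsBrauer r ↔ ∀ x, {y | r x y}.ncard = 2 := by
  have h : ∀ x, {y | r x y} = {y | r y x} := fun x => Set.ext fun y => r.comm'
  constructor
  · intro hr x
    rw [h]
    exact hr _ ⟨x, rfl⟩
  · rintro hr _ ⟨x, rfl⟩
    rw [← h]
    exact hr x

theorem ncard_map_class {V W : Type*} {f : V → W} (hf : Function.Injective f) {r : Setoid V}
    (hr : IsBrauer r) (x : V) : {y | r.map f (f x) y}.ncard = 2 := by
  have h : {y | r.map f (f x) y} = f '' {y | r x y} := by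
    ext y
    constructor
    · intro hy
      rcases (map_rel_iff hf r _ _).1 hy with ⟨u, v, huv, hu, rfl⟩ | rfl
      · rw [hf hu] at huv
        exact ⟨v, huv, rfl⟩
      · exact ⟨x, r.refl' x, rfl⟩
    · rintro ⟨v, hv, rfl⟩
      exact (map_rel_iff hf r _ _).2 (Or.inl ⟨x, v, hv, rfl, rfl⟩)
  rw [h, Set.ncard_image_of_injective _ hf]
  exact (isBrauer_iff r).1 hr x

theorem ncard_map_class_of_notMem {V W : Type*} {f : V → W} (hf : Function.Injective f)
    {r : Setoid V} (u : W) (hu : ∀ x, f x ≠ u) : {y | r.map f u y}.ncard = 1 := by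
  rw [Set.ncard_eq_one]
  refine ⟨u, Set.ext fun y => ⟨fun hy => ?_, ?_⟩⟩
  · rcases (map_rel_iff hf r _ _).1 hy with ⟨v, _, _, hv, _⟩ | h
    · exact (hu v hv).elim
    · exact h.symm
  · rintro rfl
    exact (r.map f).refl' _

theorem IsBrauer.comp [Finite X] [Finite Y] [Finite Z] {α : Setoid (X ⊕ Y)} {β : Setoid (Y ⊕ Z)}
    (hα : IsBrauer α) (hβ : IsBrauer β) : IsBrauer (comp α β) := by
  have hi₁ : Function.Injective (upperTwo : X ⊕ Y → X ⊕ (Y ⊕ Z)) :=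
    Sum.map_injective.2 ⟨Function.injective_id, Sum.inl_injective⟩
  have hi₂ : Function.Injective (lowerTwo : Y ⊕ Z → X ⊕ (Y ⊕ Z)) := Sum.inr_injective
  have hi₃ : Function.Injective (outerTwo : X ⊕ Z → X ⊕ (Y ⊕ Z)) :=
    Sum.map_injective.2 ⟨Function.injective_id, Sum.inr_injective⟩
  have hAx : ∀ x : X, {y | (α.map (upperTwo (Z := Z))) (Sum.inl x) y}.ncard = 2 := fun x =>
    ncard_map_class hi₁ hα (Sum.inl x)
  have hAy : ∀ x : Y, {y | (α.map (upperTwo (Z := Z))) (Sum.inr (Sum.inl x)) y}.ncard = 2 :=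
    fun x => ncard_map_class hi₁ hα (Sum.inr x)
  have hAz : ∀ x : Z, {y | (α.map (upperTwo (Z := Z))) (Sum.inr (Sum.inr x)) y}.ncard = 1 :=
    fun x => ncard_map_class_of_notMem hi₁ _ (by rintro (v | v) <;> simp [upperTwo])
  have hBx : ∀ x : X, {y | (β.map (lowerTwo (X := X))) (Sum.inl x) y}.ncard = 1 :=
    fun x => ncard_map_class_of_notMem hi₂ _ (by intro v; simp [lowerTwo])
  have hBy : ∀ x : Y, {y | (β.map (lowerTwo (X := X))) (Sum.inr (Sum.inl x)) y}.ncard = 2 :=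
    fun x => ncard_map_class hi₂ hβ (Sum.inl x)
  have hBz : ∀ x : Z, {y | (β.map (lowerTwo (X := X))) (Sum.inr (Sum.inr x)) y}.ncard = 2 :=
    fun x => ncard_map_class hi₂ hβ (Sum.inr x)
  obtain ⟨a, ha, hA⟩ := exists_involution (α.map (upperTwo (Z := Z))) (by
    rintro (x | y | z)
    · exact (hAx x).le
    · exact (hAy y).le
    · exact (hAz z).trans_le (by norm_num))
  obtain ⟨b, hb, hB⟩ := exists_involution (β.map (lowerTwo (X := X))) (by
    rintro (x | y | z)
    · exact (hBx x).trans_le (by norm_num)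
    · exact (hBy y).le
    · exact (hBz z).le)
  have hpair : ∀ (r : Setoid (X ⊕ (Y ⊕ Z))) (c : X ⊕ (Y ⊕ Z) → X ⊕ (Y ⊕ Z)),
      (∀ x y, r x y ↔ y = x ∨ y = c x) → ∀ x,
      ({y | r x y}.ncard = 1 → c x = x) ∧ ({y | r x y}.ncard = 2 → c x ≠ x) := by
    intro r c hc x
    have h : {y | r x y} = {x, c x} := Set.ext fun y => hc x y
    rw [h]
    constructor
    · intro h1
      by_contra hne
      rw [Set.ncard_pair (Ne.symm hne)] at h1
      omega
    · intro h2 he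
      rw [he] at h2
      simp at h2
  have hsa : ∀ v, productGraph α β v (a v) := fun v =>
    (le_sup_left : _ ≤ productGraph α β) ((hA v _).2 (Or.inr rfl))
  have hsb : ∀ v, productGraph α β v (b v) := fun v =>
    (le_sup_right : _ ≤ productGraph α β) ((hB v _).2 (Or.inr rfl))
  have hs : ∀ t : Setoid (X ⊕ (Y ⊕ Z)), (∀ x, t x (a x)) → (∀ x, t x (b x)) →
      productGraph α β ≤ t := by
    intro t hta htb
    refine sup_le (fun {u v} h => ?_) (fun {u v} h => ?_)
    · rcases (hA u v).1 h with rfl | rfl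
      · exact t.refl' _
      · exact hta u
    · rcases (hB u v).1 h with rfl | rfl
      · exact t.refl' _
      · exact htb u
  have hfix : ∀ v, (a v = v ∨ b v = v) ↔ v ∈ Set.range (outerTwo : X ⊕ Z → X ⊕ (Y ⊕ Z)) := by
    rintro (x | y | z)
    · exact ⟨fun _ => ⟨Sum.inl x, rfl⟩, fun _ => Or.inr ((hpair _ b hB _).1 (hBx x))⟩
    · constructor
      · rintro (h | h)
        · exact ((hpair _ a hA _).2 (hAy y) h).elim
        · exact ((hpair _ b hB _).2 (hBy y) h).elim
      · rintro ⟨v | v, hv⟩ <;> simp [outerTwo] at hv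
    · exact ⟨fun _ => ⟨Sum.inr z, rfl⟩, fun _ => Or.inl ((hpair _ a hA _).1 (hAz z))⟩
  rw [isBrauer_iff]
  intro w
  have himg : outerTwo '' {y | Diagram.comp α β w y} =
      {y | productGraph α β (outerTwo w) y ∧ (a y = y ∨ b y = y)} := by
    ext y
    constructor
    · rintro ⟨v, hv, rfl⟩
      exact ⟨hv, (hfix _).2 ⟨v, rfl⟩⟩
    · rintro ⟨h, hy⟩
      obtain ⟨v, rfl⟩ := (hfix _).1 hy
      exact ⟨v, h, rfl⟩
  rw [← Set.ncard_image_of_injective _ hi₃, himg]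
  rcases w with x | z
  · have h := ncard_fixed_of_involutions b a hb ha (productGraph α β) hsb hsa
      (fun t h1 h2 => hs t h2 h1) (outerTwo (Sum.inl x)) ((hpair _ b hB _).1 (hBx x))
      ((hpair _ a hA _).2 (hAx x))
    simpa only [or_comm] using h
  · exact ncard_fixed_of_involutions a b ha hb (productGraph α β) hsa hsb hs _
      ((hpair _ a hA _).1 (hAz z)) ((hpair _ b hB _).2 (hBz z))

end Composition

/-- The rank of a partition is the number of its transversals, that is, of the blocks which
contain both upper and lower vertices. -/
noncomputable def rank {m n : ℕ} (α : Partition m n) : ℕ :=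
  {B ∈ α.classes | (∃ i, Sum.inl i ∈ B) ∧ ∃ j, Sum.inr j ∈ B}.ncard

/-- The set `ℬ_{mn}` of Brauer partitions of `[m] ∪ [n]'`. -/
abbrev Brauer (m n : ℕ) : Type := {α : Partition m n // IsBrauer α}

/-- Composition in the Brauer category. -/
def Brauer.comp {m n k : ℕ} (α : Brauer m n) (β : Brauer n k) : Brauer m k :=
  ⟨Diagram.comp α.1 β.1, IsBrauer.comp α.2 β.2⟩

/-- The underlying set `ℬ_{mn}` of the sandwich semigroup `ℬ_{mn}^σ`. -/
def Sandwich {m n : ℕ} (_σ : Brauer n m) : Type := Brauer m n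

/-- The sandwich semigroup `ℬ_{mn}^σ`, with the operation `α ⋆ β = α σ β`. -/
instance {m n : ℕ} (σ : Brauer n m) : Semigroup (Sandwich σ) where
  mul α β := Brauer.comp (Brauer.comp α σ) β
  mul_assoc α β γ := Subtype.ext <| by
    change Diagram.comp (Diagram.comp (Diagram.comp (Diagram.comp α.1 σ.1) β.1) σ.1) γ.1 =
      Diagram.comp (Diagram.comp α.1 σ.1) (Diagram.comp (Diagram.comp β.1 σ.1) γ.1)
    simp only [comp_assoc]

/-- The set of (von Neumann) regular elements of a semigroup. -/
def regularElements (S : Type*) [Semigroup S] : Set S := {x | ∃ a, x = x * a * x}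

/-- The set `D_q^σ` of regular elements of rank `q` of the sandwich semigroup `ℬ_{mn}^σ`. -/
def regularRank {m n : ℕ} (σ : Brauer n m) (q : ℕ) : Set (Sandwich σ) :=
  {α ∈ regularElements (Sandwich σ) | rank α.1 = q}

/-- The double factorial, with the conventions `(-1)!! = 1` and `k!! = 0` if `k` is even. (It is
only used for odd `k ≥ -1`.) -/
def oddDoubleFactorial (k : ℤ) : ℕ := if Even k then 0 else Nat.doubleFactorial k.toNat

/-- `C(r, q) (r-q-1)!! (m+q-1)!! (n+q-1)!! / ((r+q-1)!! (2q-1)!!)`. -/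
def idempotentTerm (m n r q : ℕ) : ℚ :=
  (r.choose q * oddDoubleFactorial (r - q - 1) * oddDoubleFactorial (m + q - 1) *
      oddDoubleFactorial (n + q - 1) : ℚ) /
    (oddDoubleFactorial (r + q - 1) * oddDoubleFactorial (2 * q - 1))

end Diagram

/-! An idempotent of rank `q` factors through `q` points as `U V`, where `U` and the reflection of
`V` are full, that is, all `q` points lie on transversals. Cancelling these factors turns `α σ α =
α` into `V σ U = 1`. Conversely, any pair with `V σ U = 1` yields an idempotent `U V` of rank `q`.
Two pairs yield the same idempotent exactly when they differ by a permutation of the `q` points, so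
`q!` times the number of idempotents is the number of such pairs (`ncard_splittings`).

To count pairs, write `σ = A B` through `r` points with `A` and the reflection of `B` full. The
counting rests on `IsFull.ncard_fibre_mul`: for full `A`, all fibres of `V ↦ V A` have the same
size. Indeed, multiplying by `A` joins vertices of `V` along the upper hooks of `A` and restricts to
the remaining `q + r` vertices (`comp_eq_comap`). Permuting those vertices commutes with this
operation, and the permutations act transitively on Brauer partitions because fixed-point-free
involutions are conjugate. The fibre sizes are therefore `(q+n-1)!!/(q+r-1)!!` for `A` and
`(q+m-1)!!/(q+r-1)!!` for `B`.

This reduces `σ` to the identity on `r` points. For pairs with `W T = 1`, the factor `T` is any full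
partition, with `q! C(r,q) (r-q-1)!!` choices, and `W` lies in one fibre of multiplication by `T`,
of size `(q+r-1)!!/(2q-1)!!`. The product of all these factors, divided by `q!`, is the stated term.
-/

namespace Diagram

/-! ### Blocks of size two and relabelling of vertices. -/

section Blocks

variable {V W : Type*} {r : Setoid V}

theorem isBrauer_iff_exists :
    IsBrauer r ↔ ∀ x, ∃ y, y ≠ x ∧ ∀ z, r x z ↔ z = x ∨ z = y := by
  rw [isBrauer_iff]
  refine forall_congr' fun x => ⟨fun h => ?_, ?_⟩
  · obtain ⟨a, b, hab, hs⟩ := Set.ncard_eq_two.1 h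
    have hz : ∀ z, r x z ↔ z = a ∨ z = b := fun z => by
      simpa using Set.ext_iff.1 hs z
    rcases (hz x).1 (r.refl' x) with rfl | rfl
    · exact ⟨b, hab.symm, hz⟩
    · exact ⟨a, hab, fun z => (hz z).trans or_comm⟩
  · rintro ⟨y, hy, hz⟩
    rw [Set.ncard_eq_two]
    exact ⟨x, y, hy.symm, Set.ext hz⟩

theorem IsBrauer.eq_of_rel (h : IsBrauer r) {x y z : V} (hxy : r x y) (hxz : r x z) (hy : y ≠ x)
    (hz : z ≠ x) : y = z := by
  obtain ⟨w, -, hw⟩ := isBrauer_iff_exists.1 h x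
  rw [((hw y).1 hxy).resolve_left hy, ((hw z).1 hxz).resolve_left hz]

theorem IsBrauer.exists_rel (h : IsBrauer r) (x : V) : ∃ y, y ≠ x ∧ r x y := by
  obtain ⟨w, hne, hw⟩ := isBrauer_iff_exists.1 h x
  exact ⟨w, hne, (hw w).2 (Or.inr rfl)⟩

theorem IsBrauer.comap_equiv (h : IsBrauer r) (e : W ≃ V) : IsBrauer (r.comap e) := by
  rw [isBrauer_iff_exists] at h ⊢
  intro x
  obtain ⟨y, hy, hz⟩ := h (e x)
  refine ⟨e.symm y, fun h' => hy ?_, fun z => ?_⟩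
  · rw [← h', e.apply_symm_apply]
  · change r (e x) (e z) ↔ _
    rw [hz, e.injective.eq_iff, e.eq_symm_apply]

/-- Pulling back along an arbitrary map need not preserve joins; here the inverse of `e` carries the
join back. -/
theorem comap_equiv_sup (e : W ≃ V) (a b : Setoid V) :
    (a ⊔ b).comap e = a.comap e ⊔ b.comap e := by
  apply le_antisymm
  · have h : a ⊔ b ≤ (a.comap e ⊔ b.comap e).comap e.symm := by
      refine sup_le (fun {x y} hxy => ?_) (fun {x y} hxy => ?_)
      · refine (le_sup_left : a.comap e ≤ _) ?_
        change a (e (e.symm x)) (e (e.symm y))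
        simpa using hxy
      · refine (le_sup_right : b.comap e ≤ _) ?_
        change b (e (e.symm x)) (e (e.symm y))
        simpa using hxy
    intro x y hxy
    have h2 : (a.comap e ⊔ b.comap e) (e.symm (e x)) (e.symm (e y)) := h hxy
    simpa using h2
  · exact sup_le (fun {x y} h => (le_sup_left : a ≤ a ⊔ b) h)
      (fun {x y} h => (le_sup_right : b ≤ a ⊔ b) h)

theorem comap_equiv_injective (e : W ≃ V) :
    Function.Injective fun r : Setoid V => r.comap e := by
  intro r s h
  replace h : r.comap e = s.comap e := h
  ext x y
  have h2 : r (e (e.symm x)) (e (e.symm y)) ↔ s (e (e.symm x)) (e (e.symm y)) :=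
    Setoid.ext_iff.1 h (e.symm x) (e.symm y)
  simpa using h2

end Blocks

/-! ### Multiplication by a partition of full rank. -/

section Capping

variable {Q N R : Type*}

/-- The blocks of a partition contained in the upper row, as a partition of a two-row diagram in
which this row is the lower one. -/
def hooks (A : Setoid (N ⊕ R)) : Setoid (Q ⊕ N) := (A.comap Sum.inl).map Sum.inr

/-- If every lower vertex of `A` is joined to an upper vertex, then multiplying by `A` amounts to
joining the ends of the upper hooks of `A`. -/
theorem comp_eq_comap (V : Setoid (Q ⊕ N)) (A : Setoid (N ⊕ R)) (i : R → N)
    (hi : ∀ j, A (Sum.inl (i j)) (Sum.inr j)) :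
    comp V A = (V ⊔ hooks A).comap (Sum.map id i) := by
  -- Retraction of the product graph that slides each lower vertex up its transversal; it stays
  -- within connected components.
  let f : Q ⊕ (N ⊕ R) → Q ⊕ N := Sum.map id (Sum.elim id i)
  have hA : ∀ w : N ⊕ R, A w (Sum.inl (Sum.elim id i w)) := by
    rintro (w | w)
    · exact A.refl' _
    · exact A.symm' (hi w)
  have h : productGraph V A = (V ⊔ hooks A).comap f := by
    apply le_antisymm
    · refine sup_le ?_ ?_
      · rw [map_le_iff]
        have hf : f ∘ upperTwo = (id : Q ⊕ N → Q ⊕ N) := by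
          funext x
          rcases x with x | x <;> rfl
        intro x y hxy
        refine (le_sup_left : V ≤ _) ?_
        change V ((f ∘ upperTwo) x) ((f ∘ upperTwo) y)
        rwa [hf]
      · rw [map_le_iff]
        intro x y hxy
        refine (le_sup_right : hooks A ≤ _) ?_
        exact Relation.EqvGen.rel _ _ ⟨Sum.elim id i x, Sum.elim id i y,
          A.trans' (A.symm' (hA x)) (A.trans' hxy (hA y)), rfl, rfl⟩
    · have hle : V ⊔ hooks A ≤ (productGraph V A).comap upperTwo := by
        refine sup_le ?_ ?_
        · rw [← map_le_iff]
          exact le_sup_left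
        · rw [hooks, map_le_iff]
          intro x y hxy
          exact (le_sup_right : A.map lowerTwo ≤ productGraph V A)
            (Relation.EqvGen.rel _ _ ⟨_, _, hxy, rfl, rfl⟩)
      have hu : ∀ u, productGraph V A u (upperTwo (f u)) := by
        rintro (u | u)
        · exact (productGraph V A).refl' _
        · exact (le_sup_right : A.map lowerTwo ≤ productGraph V A)
            (Relation.EqvGen.rel _ _ ⟨_, _, hA u, rfl, rfl⟩)
      intro u v huv
      exact (productGraph V A).trans' (hu u)
        ((productGraph V A).trans' (hle huv) ((productGraph V A).symm' (hu v)))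
  rw [comp, h, ← Setoid.comap_comp]
  congr 1
  funext x
  rcases x with x | x <;> rfl

/-- The block of `i j` is used up by its transversal, so no hook meets it. Thus the vertices that
survive capping are isolated in `hooks A`. -/
theorem hooks_rel_iff {A : Setoid (N ⊕ R)} (hA : IsBrauer A) {i : R → N}
    (hi : ∀ j, A (Sum.inl (i j)) (Sum.inr j)) (w : Q ⊕ R) (u : Q ⊕ N) :
    hooks A (Sum.map id i w) u ↔ u = Sum.map id i w := by
  rw [hooks, map_rel_iff Sum.inr_injective]
  constructor
  · rintro (⟨x, y, hxy, hx, rfl⟩ | h)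
    · rcases w with w | w
      · simp at hx
      · have hx' : x = i w := by simpa using hx
        subst hx'
        by_contra hne
        have := hA.eq_of_rel hxy (hi w) (by simpa using hne) (by simp)
        simp at this
    · exact h.symm
  · rintro rfl
    exact Or.inr rfl

/-- Multiplication by a partition all of whose lower vertices are in transversals commutes with
permutations of the outer vertices. -/
theorem comp_comap_viaEmbedding (V : Setoid (Q ⊕ N)) {A : Setoid (N ⊕ R)} (hA : IsBrauer A)
    {i : R → N} (hi : ∀ j, A (Sum.inl (i j)) (Sum.inr j)) (e : Q ⊕ R ↪ Q ⊕ N)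
    (he : ∀ w, e w = Sum.map id i w) (p : Equiv.Perm (Q ⊕ R)) :
    comp (V.comap (p.viaEmbedding e)) A = (comp V A).comap p := by
  -- The extended permutation moves only vertices that are isolated in `hooks A`, and it maps the
  -- set of them to itself.
  have hK : (hooks A : Setoid (Q ⊕ N)).comap (p.viaEmbedding e) = hooks A := by
    have hin : ∀ w u, (hooks A : Setoid (Q ⊕ N)) (e w) u ↔ u = e w := fun w u => by
      rw [he]
      exact hooks_rel_iff hA hi w u
    have key : ∀ w v, (hooks A : Setoid (Q ⊕ N)) (p.viaEmbedding e (e w)) (p.viaEmbedding e v) ↔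
        hooks A (e w) v := by
      intro w v
      have h := (p.viaEmbedding e).injective.eq_iff (a := v) (b := e w)
      rw [hin, ← h, Equiv.Perm.viaEmbedding_apply, hin]
    ext u v
    change (hooks A) (p.viaEmbedding e u) (p.viaEmbedding e v) ↔ _
    by_cases hu : u ∈ Set.range e
    · obtain ⟨w, rfl⟩ := hu
      exact key w v
    by_cases hv : v ∈ Set.range e
    · obtain ⟨w, rfl⟩ := hv
      rw [Setoid.comm', key, Setoid.comm']
    · rw [Equiv.Perm.viaEmbedding_apply_of_notMem _ _ _ hu,
        Equiv.Perm.viaEmbedding_apply_of_notMem _ _ _ hv]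
  have he' : Sum.map id i = e := funext fun w => (he w).symm
  have h : V.comap (p.viaEmbedding e) ⊔ hooks A = (V ⊔ hooks A).comap (p.viaEmbedding e) := by
    rw [comap_equiv_sup, hK]
  rw [comp_eq_comap _ A i hi, comp_eq_comap _ A i hi, h, he']
  ext x y
  change (V ⊔ hooks A) (p.viaEmbedding e (e x)) (p.viaEmbedding e (e y)) ↔
    (V ⊔ hooks A) (e (p x)) (e (p y))
  rw [Equiv.Perm.viaEmbedding_apply, Equiv.Perm.viaEmbedding_apply]

end Capping

/-! ### The Brauer category: reflection, identities, full partitions. -/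

namespace Brauer

variable {m n k l q r : ℕ}

theorem comp_assoc (α : Brauer m n) (β : Brauer n k) (γ : Brauer k l) :
    (α.comp β).comp γ = α.comp (β.comp γ) :=
  Subtype.ext (Diagram.comp_assoc _ _ _)

/-- Reflection in a horizontal axis. -/
def flip (α : Brauer m n) : Brauer n m :=
  ⟨α.1.comap (Equiv.sumComm _ _), α.2.comap_equiv _⟩

@[simp]
theorem flip_flip (α : Brauer m n) : α.flip.flip = α := by
  refine Subtype.ext ?_
  ext x y
  change α.1 x.swap.swap y.swap.swap ↔ _
  simp

theorem flip_comp (α : Brauer m n) (β : Brauer n k) :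
    (α.comp β).flip = β.flip.comp α.flip := by
  refine Subtype.ext ?_
  let g : Fin k ⊕ (Fin n ⊕ Fin m) ≃ Fin m ⊕ (Fin n ⊕ Fin k) :=
    { toFun := Sum.elim (Sum.inr ∘ Sum.inr) (Sum.elim (Sum.inr ∘ Sum.inl) Sum.inl)
      invFun := Sum.elim (Sum.inr ∘ Sum.inr) (Sum.elim (Sum.inr ∘ Sum.inl) Sum.inl)
      left_inv := by rintro (x | x | x) <;> rfl
      right_inv := by rintro (x | x | x) <;> rfl }
  have h : (productGraph α.1 β.1).comap g = productGraph β.flip.1 α.flip.1 := by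
    rw [productGraph, comap_equiv_sup, sup_comm, productGraph]
    congr 1
    · refine comap_map_of_pullback (o := Sum.swap) (i := upperTwo) Sum.inr_injective g.injective
        ?_ ?_ _
      · rintro (v | v) <;> rfl
      · rintro (v | v) (x | x | x) h <;> simp [g] at h <;> subst h
        · exact ⟨Sum.inr v, rfl, rfl⟩
        · exact ⟨Sum.inl v, rfl, rfl⟩
    · refine comap_map_of_pullback (o := Sum.swap) (i := lowerTwo)
        (Sum.map_injective.2 ⟨Function.injective_id, Sum.inl_injective⟩) g.injective ?_ ?_ _
      · rintro (v | v) <;> rfl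
      · rintro (v | v) (x | x | x) h <;> simp [g] at h <;> subst h
        · exact ⟨Sum.inr v, rfl, rfl⟩
        · exact ⟨Sum.inl v, rfl, rfl⟩
  change ((productGraph α.1 β.1).comap outerTwo).comap (Equiv.sumComm _ _) =
    (productGraph β.flip.1 α.flip.1).comap outerTwo
  rw [← h]
  ext x y
  rcases x with x | x <;> rcases y with y | y <;> rfl

/-- The identity of the Brauer monoid `ℬ_{qq}`. -/
def one (q : ℕ) : Brauer q q :=
  ⟨Setoid.ker (Sum.elim id id), isBrauer_iff_exists.2 <| by
    rintro (x | x)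
    · refine ⟨Sum.inr x, by simp, ?_⟩
      rintro (z | z) <;> simp [Setoid.ker_def, eq_comm]
    · refine ⟨Sum.inl x, by simp, ?_⟩
      rintro (z | z) <;> simp [Setoid.ker_def, eq_comm]⟩

@[simp]
theorem flip_one (q : ℕ) : (one q).flip = one q := by
  refine Subtype.ext ?_
  ext x y
  change Sum.elim id id x.swap = Sum.elim id id y.swap ↔ Sum.elim id id x = Sum.elim id id y
  rcases x with x | x <;> rcases y with y | y <;> rfl

@[simp]
theorem comp_one (α : Brauer m q) : α.comp (one q) = α := by
  refine Subtype.ext ?_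
  change Diagram.comp α.1 (one q).1 = α.1
  rw [comp_eq_comap _ _ id (fun j => rfl)]
  have h : (hooks (one q).1 : Setoid (Fin m ⊕ Fin q)) ≤ α.1 := by
    rw [hooks, map_le_iff]
    intro x y hxy
    have : x = y := hxy
    rw [this]
  rw [sup_eq_left.2 h]
  ext x y
  change α.1 (Sum.map id id x) (Sum.map id id y) ↔ _
  simp

@[simp]
theorem one_comp (α : Brauer q n) : (one q).comp α = α := by
  rw [← flip_flip ((one q).comp α), flip_comp, flip_one, comp_one, flip_flip]

/-- Every lower vertex belongs to a transversal. -/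
def IsFull (A : Brauer n r) : Prop := ∀ j, ∃ i, A.1 (Sum.inl i) (Sum.inr j)

/-- The upper hooks of `A` are already blocks of `A.flip`, so capping adds nothing and only the
transversals of `A`, traversed back and forth, remain. -/
theorem IsFull.flip_comp_self {A : Brauer n r} (h : A.IsFull) : A.flip.comp A = one r := by
  choose i hi using h
  refine Subtype.ext ?_
  change Diagram.comp A.flip.1 A.1 = (one r).1
  rw [comp_eq_comap _ _ i hi]
  have h : (hooks A.1 : Setoid (Fin r ⊕ Fin n)) ≤ A.flip.1 := by
    rw [hooks, map_le_iff]
    intro x y hxy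
    exact hxy
  rw [sup_eq_left.2 h]
  have hx : ∀ x : Fin r ⊕ Fin r,
      A.flip.1 (Sum.map id i x) (Sum.inl (Sum.elim id id x)) := by
    rintro (x | x)
    · exact Setoid.refl' _ _
    · exact hi x
  have hj : ∀ j j', A.1 (Sum.inr j) (Sum.inr j') → j = j' := by
    intro j j' hjj
    by_contra hne
    have := A.2.eq_of_rel hjj (Setoid.symm' _ (hi j)) (by simpa using Ne.symm hne) (by simp)
    simp at this
  ext x y
  constructor
  · intro hxy
    exact hj _ _ (Setoid.trans' A.flip.1 (Setoid.symm' _ (hx x)) (Setoid.trans' _ hxy (hx y)))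
  · intro hxy
    have hxy' : Sum.elim id id x = Sum.elim id id y := hxy
    refine Setoid.trans' A.flip.1 (hx x) (Setoid.symm' _ ?_)
    rw [hxy']
    exact hx y

/-- A lower hook of `A` would survive as a lower hook of the product, but the identity has none. -/
theorem isFull_of_comp_eq_one {X : Brauer r n} {A : Brauer n r} (h : X.comp A = one r) :
    A.IsFull := by
  intro j
  obtain ⟨y, hy, hj⟩ := A.2.exists_rel (Sum.inr j)
  rcases y with y | y
  · exact ⟨y, Setoid.symm' _ hj⟩
  · have h1 : (X.comp A).1 (Sum.inr j) (Sum.inr y) :=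
      (le_sup_right : A.1.map lowerTwo ≤ productGraph X.1 A.1)
        (Relation.EqvGen.rel _ _ ⟨_, _, hj, rfl, rfl⟩)
    rw [h] at h1
    have : j = y := h1
    exact (hy (by rw [this])).elim

/-- With equally many vertices in both rows, an injection from the lower to the upper row is onto:
full square partitions are permutations. -/
theorem IsFull.flip {P : Brauer q q} (h : P.IsFull) : P.flip.IsFull := by
  have h' := h
  choose i hi using h
  have hinj : Function.Injective i := by
    intro j j' hjj
    by_contra hne
    have h1 := hi j'
    rw [← hjj] at h1
    have := P.2.eq_of_rel (hi j) h1 (by simp) (by simp)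
    exact hne (by simpa using this)
  intro x
  obtain ⟨j, rfl⟩ := (Finite.injective_iff_surjective.1 hinj) x
  exact ⟨j, Setoid.symm' _ (hi j)⟩

theorem IsFull.comp_flip_self {P : Brauer q q} (h : P.IsFull) : P.comp P.flip = one q := by
  simpa using h.flip.flip_comp_self

theorem inr_eq_of_rel (α : Brauer m n) {x : Fin m} {y y' : Fin n}
    (h : α.1 (Sum.inl x) (Sum.inr y)) (h' : α.1 (Sum.inl x) (Sum.inr y')) : y = y' := by
  simpa using α.2.eq_of_rel h h' (by simp) (by simp)

theorem inl_eq_of_rel (α : Brauer m n) {x x' : Fin m} {y : Fin n}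
    (h : α.1 (Sum.inl x) (Sum.inr y)) (h' : α.1 (Sum.inl x') (Sum.inr y)) : x = x' := by
  simpa using α.2.eq_of_rel (Setoid.symm' _ h) (Setoid.symm' _ h') (by simp) (by simp)

theorem eq_of_rel_of_rel (α : Brauer m n) {x x' : Fin m} {y : Fin n}
    (h : α.1 (Sum.inl x) (Sum.inr y)) (h' : α.1 (Sum.inl x) (Sum.inl x')) : x' = x := by
  by_contra hne
  have := α.2.eq_of_rel h h' (by simp) (by simpa using hne)
  simp at this

/-! ### Rank and factorisation through `rank` many points. -/

theorem rank_eq (α : Brauer m n) :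
    rank α.1 = {x | ∃ y, α.1 (Sum.inl x) (Sum.inr y)}.ncard := by
  have h : {B ∈ α.1.classes | (∃ i, Sum.inl i ∈ B) ∧ ∃ j, Sum.inr j ∈ B} =
      (fun x => {z | α.1 z (Sum.inl x)}) '' {x | ∃ y, α.1 (Sum.inl x) (Sum.inr y)} := by
    ext B
    constructor
    · rintro ⟨⟨w, rfl⟩, ⟨i, hi⟩, ⟨j, hj⟩⟩
      refine ⟨i, ⟨j, Setoid.trans' _ hi (Setoid.symm' _ hj)⟩, ?_⟩
      ext z
      exact ⟨fun h => Setoid.trans' _ h hi, fun h => Setoid.trans' _ h (Setoid.symm' _ hi)⟩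
    · rintro ⟨x, ⟨y, hxy⟩, rfl⟩
      exact ⟨⟨_, rfl⟩, ⟨x, Setoid.refl' _ _⟩, ⟨y, Setoid.symm' _ hxy⟩⟩
  rw [rank, h]
  refine Set.InjOn.ncard_image ?_
  rintro x ⟨y, hxy⟩ x' - hxx
  have h' : Sum.inl x' ∈ {z | α.1 z (Sum.inl x)} := by
    rw [show {z | α.1 z (Sum.inl x)} = {z | α.1 z (Sum.inl x')} from hxx]
    exact Setoid.refl' _ _
  exact (eq_of_rel_of_rel α hxy (Setoid.symm' _ h')).symm

theorem rank_flip (α : Brauer m n) : rank α.flip.1 = rank α.1 := by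
  rw [rank_eq, rank_eq]
  symm
  refine Set.ncard_congr (fun x hx => hx.choose) ?_ ?_ ?_
  · exact fun x hx => ⟨x, Setoid.symm' α.1 hx.choose_spec⟩
  · intro x x' hx hx' h
    have h1 := hx.choose_spec
    rw [h] at h1
    exact inl_eq_of_rel α h1 hx'.choose_spec
  · rintro y ⟨x, hx⟩
    have hx' : α.1 (Sum.inl x) (Sum.inr y) := Setoid.symm' α.1 hx
    have hex : ∃ y, α.1 (Sum.inl x) (Sum.inr y) := ⟨y, hx'⟩
    exact ⟨x, hex, inr_eq_of_rel α hex.choose_spec hx'⟩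

/-- If `x` is not on a transversal of `α`, its block is an upper hook untouched by `β`, hence a
whole component of the product graph that never reaches the bottom row. -/
theorem rank_comp_le_left (α : Brauer m n) (β : Brauer n k) :
    rank (α.comp β).1 ≤ rank α.1 := by
  rw [rank_eq, rank_eq]
  refine Set.ncard_le_ncard ?_ (Set.toFinite _)
  rintro x ⟨y, hxy⟩
  by_contra hx
  have hx' : ∀ y, ¬ α.1 (Sum.inl x) (Sum.inr y) := fun y h => hx ⟨y, h⟩
  let S : Set (Fin m ⊕ (Fin n ⊕ Fin k)) := {u | ∃ z, α.1 (Sum.inl x) (Sum.inl z) ∧ u = Sum.inl z}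
  let s : Setoid (Fin m ⊕ (Fin n ⊕ Fin k)) :=
    { r := fun u v => u ∈ S ↔ v ∈ S
      iseqv := ⟨fun _ => Iff.rfl, fun h => h.symm, fun h h' => h.trans h'⟩ }
  have hle : productGraph α.1 β.1 ≤ s := by
    have hS : ∀ u : Fin m ⊕ Fin n, (upperTwo u : Fin m ⊕ (Fin n ⊕ Fin k)) ∈ S ↔
        α.1 (Sum.inl x) u := by
      rintro (u | u)
      · constructor
        · rintro ⟨z, hz, h⟩
          have : u = z := by simpa [upperTwo] using h
          rwa [this]
        · exact fun h => ⟨u, h, rfl⟩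
      · exact ⟨fun ⟨z, hz, h⟩ => by simp [upperTwo] at h, fun h => (hx' u h).elim⟩
    refine sup_le ?_ ?_
    · rw [map_le_iff]
      intro u v huv
      change upperTwo u ∈ S ↔ upperTwo v ∈ S
      rw [hS, hS]
      exact ⟨fun h => Setoid.trans' _ h huv, fun h => Setoid.trans' _ h (Setoid.symm' _ huv)⟩
    · rw [map_le_iff]
      intro u v huv
      exact ⟨fun ⟨z, _, h⟩ => by simp [lowerTwo] at h, fun ⟨z, _, h⟩ => by simp [lowerTwo] at h⟩
  obtain ⟨z, -, h⟩ := (hle hxy).1 ⟨x, Setoid.refl' _ _, rfl⟩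
  simp [outerTwo] at h

theorem rank_comp_le_right (α : Brauer m n) (β : Brauer n k) :
    rank (α.comp β).1 ≤ rank β.1 := by
  rw [← rank_flip, flip_comp, ← rank_flip β]
  exact rank_comp_le_left _ _

theorem rank_le_left (α : Brauer m n) : rank α.1 ≤ m := by
  rw [rank_eq]
  exact (Set.ncard_le_card _).trans_eq (by simp)

theorem rank_one (q : ℕ) : rank (one q).1 = q := by
  have h : {x | ∃ y, (one q).1 (Sum.inl x) (Sum.inr y)} = Set.univ :=
    Set.eq_univ_of_forall fun x => ⟨x, rfl⟩
  rw [rank_eq, h]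
  simp

/-- Multiplying by the two reflections recovers `one q`, and multiplication cannot raise the rank.
-/
theorem rank_comp_of_isFull {U : Brauer m q} {V : Brauer q n} (hU : U.IsFull)
    (hV : V.flip.IsFull) : rank (U.comp V).1 = q := by
  apply le_antisymm
  · exact (rank_comp_le_right U V).trans (rank_le_left V)
  · have h : (U.flip.comp (U.comp V)).comp V.flip = one q := by
      rw [← comp_assoc, hU.flip_comp_self, one_comp]
      simpa using hV.flip_comp_self
    calc q = rank ((U.flip.comp (U.comp V)).comp V.flip).1 := by rw [h, rank_one]
      _ ≤ rank (U.flip.comp (U.comp V)).1 := rank_comp_le_left _ _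
      _ ≤ rank (U.comp V).1 := rank_comp_le_right _ _

/-- The upper half of a partition, its lower vertices indexing transversals. -/
theorem isBrauer_comap (α : Brauer m n) {a : Fin q → Fin m} {b : Fin q → Fin n}
    (hab : ∀ k, α.1 (Sum.inl (a k)) (Sum.inr (b k))) (ha : Function.Injective a)
    (hT : ∀ x y, α.1 (Sum.inl x) (Sum.inr y) → ∃ k, a k = x) :
    IsBrauer (α.1.comap (Sum.map id b : Fin m ⊕ Fin q → Fin m ⊕ Fin n)) := by
  have hb : ∀ k k', α.1 (Sum.inr (b k)) (Sum.inr (b k')) → k = k' := by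
    intro k k' h
    apply ha
    exact (eq_of_rel_of_rel α (hab k) (Setoid.trans' _ (hab k)
      (Setoid.trans' _ h (Setoid.symm' _ (hab k'))))).symm
  rw [isBrauer_iff_exists]
  have key : ∀ k, ∀ z : Fin m ⊕ Fin q, α.1 (Sum.inl (a k)) (Sum.map id b z) ↔
      z = Sum.inl (a k) ∨ z = Sum.inr k := by
    rintro k (z | z)
    · constructor
      · exact fun h => Or.inl (congrArg _ (eq_of_rel_of_rel α (hab k) h))
      · rintro (h | h)
        · rw [h]
          exact Setoid.refl' _ _
        · simp at h
    · constructor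
      · exact fun h => Or.inr (congrArg _ (hb _ _ (Setoid.trans' _ (Setoid.symm' _ h) (hab k))))
      · rintro (h | h)
        · simp at h
        · rw [h]
          exact hab k
  rintro (x | k)
  · obtain ⟨w, hw, hxw⟩ := isBrauer_iff_exists.1 α.2 (Sum.inl x)
    rcases w with w | w
    · refine ⟨Sum.inl w, by simpa using hw, ?_⟩
      rintro (z | z)
      · refine (hxw (Sum.inl z)).trans ?_
        simp
      · refine (hxw (Sum.inr (b z))).trans ?_
        simp
    · obtain ⟨k, rfl⟩ := hT x w ((hxw _).2 (Or.inr rfl))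
      exact ⟨Sum.inr k, by simp, key k⟩
  · refine ⟨Sum.inl (a k), by simp, fun z => ?_⟩
    rw [or_comm, ← key]
    exact ⟨fun h => Setoid.trans' α.1 (hab k) h,
      fun h => Setoid.trans' α.1 (Setoid.symm' _ (hab k)) h⟩

/-- Every Brauer partition of rank `q` factors through `q` points. -/
theorem exists_eq_comp (α : Brauer m n) :
    ∃ (U : Brauer m (rank α.1)) (V : Brauer (rank α.1) n),
      U.IsFull ∧ V.flip.IsFull ∧ U.comp V = α := by
  obtain ⟨q, hq⟩ : ∃ q, q = rank α.1 := ⟨_, rfl⟩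
  rw [← hq]
  rw [rank_eq] at hq
  let T : Set (Fin m) := {x | ∃ y, α.1 (Sum.inl x) (Sum.inr y)}
  have e : Fin q ≃ T := (finCongr hq).trans (Finite.equivFin T).symm
  let a : Fin q → Fin m := fun k => (e k).1
  have ha : Function.Injective a := Subtype.val_injective.comp e.injective
  have hex : ∀ k, ∃ y, α.1 (Sum.inl (a k)) (Sum.inr y) := fun k => (e k).2
  choose b hab using hex
  have hT : ∀ x y, α.1 (Sum.inl x) (Sum.inr y) → ∃ k, a k = x := fun x y h =>
    ⟨e.symm ⟨x, y, h⟩, by simp [a]⟩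
  have hb : Function.Injective b := by
    intro k k' h
    apply ha
    have h1 := hab k
    rw [h] at h1
    exact inl_eq_of_rel α h1 (hab k')
  have hT' : ∀ y x, α.flip.1 (Sum.inl y) (Sum.inr x) → ∃ k, b k = y := by
    intro y x h
    obtain ⟨k, rfl⟩ := hT x y (Setoid.symm' α.1 h)
    exact ⟨k, inr_eq_of_rel α (hab k) (Setoid.symm' α.1 h)⟩
  -- The point `k` stands for the lower end `b k` of the `k`th transversal in `U`, and for its upper
  -- end `a k` in `V'.flip`.
  let U : Brauer m q := ⟨_, isBrauer_comap α hab ha hT⟩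
  let V' : Brauer n q := ⟨_, isBrauer_comap α.flip (fun k => Setoid.symm' α.1 (hab k)) hb hT'⟩
  have hV : ∀ x y, V'.flip.1 x y ↔ α.1 (Sum.map a id x) (Sum.map a id y) := by
    rintro (x | x) (y | y) <;> rfl
  refine ⟨U, V'.flip, fun k => ⟨a k, hab k⟩, ?_, Subtype.ext (le_antisymm ?_ ?_)⟩
  · rw [flip_flip]
    exact fun k => ⟨b k, Setoid.symm' α.1 (hab k)⟩
  · let g : Fin m ⊕ (Fin q ⊕ Fin n) → Fin m ⊕ Fin n := Sum.elim Sum.inl (Sum.map a id)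
    have h : productGraph U.1 V'.flip.1 ≤ α.1.comap g := by
      refine sup_le ?_ ?_
      · rw [map_le_iff]
        have hg : ∀ u : Fin m ⊕ Fin q, α.1 (Sum.map id b u) (g (upperTwo u)) := by
          rintro (u | u)
          · exact Setoid.refl' _ _
          · exact Setoid.symm' _ (hab u)
        intro u v huv
        exact Setoid.trans' α.1 (Setoid.symm' _ (hg u)) (Setoid.trans' _ huv (hg v))
      · rw [map_le_iff]
        intro u v huv
        exact (hV u v).1 huv
    intro x y hxy
    have hxy' : α.1 (g (outerTwo x)) (g (outerTwo y)) := h hxy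
    rcases x with x | x <;> rcases y with y | y <;> exact hxy'
  · have hU1 : ∀ u v, U.1 u v → productGraph U.1 V'.flip.1 (upperTwo u) (upperTwo v) :=
      fun u v h => (le_sup_left : U.1.map upperTwo ≤ productGraph U.1 V'.flip.1)
        (Relation.EqvGen.rel _ _ ⟨_, _, h, rfl, rfl⟩)
    have hV1 : ∀ u v, V'.flip.1 u v → productGraph U.1 V'.flip.1 (lowerTwo u) (lowerTwo v) :=
      fun u v h => (le_sup_right : V'.flip.1.map lowerTwo ≤ productGraph U.1 V'.flip.1)
        (Relation.EqvGen.rel _ _ ⟨_, _, h, rfl, rfl⟩)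
    have hmix : ∀ x y, α.1 (Sum.inl x) (Sum.inr y) →
        productGraph U.1 V'.flip.1 (Sum.inl x) (Sum.inr (Sum.inr y)) := by
      intro x y h
      obtain ⟨k, rfl⟩ := hT x y h
      exact Setoid.trans' _ (hU1 (Sum.inl (a k)) (Sum.inr k) (hab k))
        (hV1 (Sum.inl k) (Sum.inr y) ((hV _ _).2 h))
    rintro (x | x) (y | y) hxy
    · exact hU1 (Sum.inl x) (Sum.inl y) hxy
    · exact hmix _ _ hxy
    · exact Setoid.symm' _ (hmix _ _ (Setoid.symm' _ hxy))
    · exact hV1 (Sum.inr x) (Sum.inr y) ((hV _ _).2 hxy)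

end Brauer

/-! ### Counting Brauer partitions through fixed-point-free involutions. -/

section Counting

variable {V : Type*}

instance [Finite V] : Finite (Setoid V) :=
  Finite.of_injective (fun r : Setoid V => fun x y => r x y) fun r s h => by
    ext x y
    exact iff_of_eq (congrFun (congrFun h x) y)

theorem cycleType_eq_replicate_iff [Fintype V] [DecidableEq V] (p : Equiv.Perm V) :
    ((∀ x, p (p x) = x) ∧ ∀ x, p x ≠ x) ↔
      Even (Fintype.card V) ∧ p.cycleType = Multiset.replicate (Fintype.card V / 2) 2 := by
  have hs : (∀ x, p x ≠ x) ↔ p.support.card = Fintype.card V := by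
    rw [Finset.card_eq_iff_eq_univ, Finset.eq_univ_iff_forall]
    simp
  have h2 : (∀ x, p (p x) = x) ↔ p ^ 2 = 1 := by
    rw [Equiv.Perm.ext_iff]
    simp [pow_two]
  rw [hs, h2, ← Equiv.Perm.sum_cycleType]
  constructor
  · rintro ⟨h, hc⟩
    have hr := Equiv.Perm.cycleType_of_pow_prime_eq_one h
    have hc' : p.cycleType.card * 2 = Fintype.card V := by
      rw [← hc]
      conv_rhs => rw [hr]
      simp
    refine ⟨⟨p.cycleType.card, by omega⟩, ?_⟩
    rw [← hc', Nat.mul_div_cancel _ two_pos]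
    exact hr
  · rintro ⟨he, h⟩
    constructor
    · rw [Equiv.Perm.pow_prime_eq_one_iff, h]
      exact fun c hc => Multiset.eq_of_mem_replicate hc
    · rw [h]
      simpa using Nat.div_mul_cancel he.two_dvd

theorem IsBrauer.exists_perm [Fintype V] [DecidableEq V] {r : Setoid V} (h : IsBrauer r) :
    ∃ p : Equiv.Perm V, (Even (Fintype.card V) ∧
      p.cycleType = Multiset.replicate (Fintype.card V / 2) 2) ∧
      ∀ x y, r x y ↔ y = x ∨ y = p x := by
  obtain ⟨a, ha, hr⟩ := exists_involution r fun x => ((isBrauer_iff r).1 h x).le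
  refine ⟨⟨a, a, ha, ha⟩, (cycleType_eq_replicate_iff _).1 ⟨ha, fun x hx => ?_⟩, hr⟩
  obtain ⟨y, hy, hxy⟩ := h.exists_rel x
  rcases (hr x y).1 hxy with h1 | h1
  · exact hy h1
  · exact hy (h1.trans hx)

theorem IsBrauer.even_card [Fintype V] {r : Setoid V} (h : IsBrauer r) :
    Even (Fintype.card V) := by
  classical
  obtain ⟨p, ⟨hp, -⟩, -⟩ := h.exists_perm
  exact hp

/-- The associated involutions have the same cycle type, hence are conjugate; the conjugating
permutation is the relabelling. -/
theorem IsBrauer.exists_comap_eq [Finite V] {r s : Setoid V} (hr : IsBrauer r) (hs : IsBrauer s) :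
    ∃ c : Equiv.Perm V, s.comap c = r := by
  classical
  cases nonempty_fintype V
  obtain ⟨p, ⟨-, hp⟩, hrp⟩ := hr.exists_perm
  obtain ⟨p', ⟨-, hp'⟩, hsp⟩ := hs.exists_perm
  obtain ⟨c, hc⟩ := isConj_iff.1 (Equiv.Perm.isConj_iff_cycleType_eq.2 (hp.trans hp'.symm))
  refine ⟨c, ?_⟩
  ext x y
  change s (c x) (c y) ↔ r x y
  rw [hsp, hrp, ← hc]
  simp

theorem oddDoubleFactorial_two_mul_sub_one (k : ℕ) :
    oddDoubleFactorial (2 * (k : ℤ) - 1) * (2 ^ k * k.factorial) = (2 * k).factorial := by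
  rw [oddDoubleFactorial, if_neg (by simp), ← Nat.doubleFactorial_two_mul]
  -- For `k = 0`, `toNat` truncates `-1` to `0`, and `0!! = 1` supplies the convention `(-1)!! = 1`.
  rcases k with _ | k
  · rfl
  · have h : (2 * ((k + 1 : ℕ) : ℤ) - 1).toNat = 2 * k + 1 := by omega
    rw [h, show 2 * (k + 1) = 2 * k + 1 + 1 by ring, Nat.factorial_eq_mul_doubleFactorial, mul_comm]

/-- Sending a partition to its involution identifies the set with the conjugacy class of cycle type
`2^k`, of size `(2k)!/(2^k k!)`. -/
theorem card_isBrauer [Fintype V] (h : Even (Fintype.card V)) :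
    {r : Setoid V | IsBrauer r}.ncard = oddDoubleFactorial ((Fintype.card V : ℤ) - 1) := by
  classical
  have h1 : {r : Setoid V | IsBrauer r}.ncard =
      (↑({p | p.cycleType = Multiset.replicate (Fintype.card V / 2) 2} : Finset (Equiv.Perm V)) :
        Set (Equiv.Perm V)).ncard := by
    refine Set.ncard_congr (fun r hr => (IsBrauer.exists_perm hr).choose) ?_ ?_ ?_
    · intro r hr
      simpa using (IsBrauer.exists_perm hr).choose_spec.1.2
    · intro r s hr hs hrs
      ext x y
      rw [(IsBrauer.exists_perm hr).choose_spec.2, (IsBrauer.exists_perm hs).choose_spec.2, hrs]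
    · intro p hp
      obtain ⟨hpp, hpf⟩ := (cycleType_eq_replicate_iff p).2 ⟨h, by simpa using hp⟩
      let r : Setoid V :=
        { r := fun x y => y = x ∨ y = p x
          iseqv := by
            refine ⟨fun x => Or.inl rfl, ?_, ?_⟩
            · rintro x y (rfl | rfl)
              · exact Or.inl rfl
              · exact Or.inr (hpp x).symm
            · rintro x y z (rfl | rfl) (rfl | rfl)
              · exact Or.inl rfl
              · exact Or.inr rfl
              · exact Or.inr rfl
              · exact Or.inl (hpp x) }
      have hr : IsBrauer r := isBrauer_iff_exists.2 fun x => ⟨p x, hpf x, fun z => Iff.rfl⟩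
      refine ⟨r, hr, Equiv.ext fun x => ?_⟩
      have h2 : r x (p x) := Or.inr rfl
      rw [(IsBrauer.exists_perm hr).choose_spec.2] at h2
      exact (h2.resolve_left (hpf x)).symm
  rw [h1, Set.ncard_coe_finset]
  obtain ⟨k, hk⟩ := h
  have hk2 : Fintype.card V / 2 = k := by omega
  have hcount := Equiv.Perm.card_of_cycleType_mul_eq V (Multiset.replicate k 2)
  have hprod : (∏ n ∈ (Multiset.replicate k 2).toFinset,
      (Multiset.count n (Multiset.replicate k 2)).factorial) = k.factorial := by
    rcases Nat.eq_zero_or_pos k with rfl | hpos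
    · simp
    · rw [Multiset.toFinset_replicate, if_neg hpos.ne']
      simp
  have hsum : (Multiset.replicate k 2).sum = Fintype.card V := by
    simp
    omega
  rw [hsum, hprod, if_pos ⟨le_rfl, fun a ha => (Multiset.eq_of_mem_replicate ha).ge⟩,
    Multiset.prod_replicate, Nat.sub_self, Nat.factorial_zero, one_mul] at hcount
  rw [hk2]
  have hpos : 0 < 2 ^ k * k.factorial := by positivity
  refine Nat.eq_of_mul_eq_mul_right hpos ?_
  rw [hcount, hk, ← two_mul, ← oddDoubleFactorial_two_mul_sub_one k]
  push_cast
  rfl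

/-- A map all of whose fibres have the same size. -/
theorem ncard_eq_mul_of_fibres {S T : Type*} [Finite S] [Finite T] {s : Set S} {t : Set T}
    (f : S → T) (hf : Set.MapsTo f s t) {c : ℕ} (hc : ∀ b ∈ t, {a ∈ s | f a = b}.ncard = c) :
    s.ncard = t.ncard * c := by
  classical
  cases nonempty_fintype S
  cases nonempty_fintype T
  rw [Set.ncard_eq_toFinset_card' s, Set.ncard_eq_toFinset_card' t,
    Finset.card_eq_sum_card_fiberwise (f := f) (t := t.toFinset) (by simpa using hf),
    ← smul_eq_mul, ← Finset.sum_const]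
  refine Finset.sum_congr rfl fun b hb => ?_
  rw [← hc b (by simpa using hb), Set.ncard_eq_toFinset_card']
  congr 1
  ext a
  simp

end Counting

/-! ### Fibres of multiplication and the number of full partitions. -/

namespace Brauer

variable {m n k q r : ℕ}

theorem even_add (α : Brauer m n) : Even (m + n) := by
  simpa using α.2.even_card

theorem ncard_univ (h : Even (m + n)) :
    (Set.univ : Set (Brauer m n)).ncard = oddDoubleFactorial ((m : ℤ) + n - 1) := by
  have h1 := card_isBrauer (V := Fin m ⊕ Fin n) (by simpa using h)
  rw [Set.ncard_univ]
  exact h1.trans (by simp)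

/-- Multiplication on the right by a partition of full rank is an equidistributed map. -/
theorem IsFull.ncard_fibre_mul {A : Brauer n r} (hA : A.IsFull) (W : Brauer q r) :
    {V : Brauer q n | V.comp A = W}.ncard * (Set.univ : Set (Brauer q r)).ncard =
      (Set.univ : Set (Brauer q n)).ncard := by
  have hA' := hA
  choose i hi using hA'
  have hinj : Function.Injective i := by
    intro j j' h
    have h1 := hi j
    rw [h] at h1
    exact inr_eq_of_rel A h1 (hi j')
  let e : Fin q ⊕ Fin r ↪ Fin q ⊕ Fin n :=
    ⟨Sum.map id i, Sum.map_injective.2 ⟨Function.injective_id, hinj⟩⟩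
  have hle : ∀ W₁ W₂ : Brauer q r,
      {V : Brauer q n | V.comp A = W₁}.ncard ≤ {V : Brauer q n | V.comp A = W₂}.ncard := by
    intro W₁ W₂
    -- Relabelling by the extension of `c` maps one fibre injectively into the other; exchanging the
    -- roles of `W₁` and `W₂` gives equality.
    obtain ⟨c, hc⟩ := W₂.2.exists_comap_eq W₁.2
    refine Set.ncard_le_ncard_of_injOn
      (fun V => ⟨V.1.comap (c.viaEmbedding e), V.2.comap_equiv _⟩) ?_ ?_ (Set.toFinite _)
    · rintro V rfl
      refine Subtype.ext ?_
      exact (comp_comap_viaEmbedding V.1 A.2 hi e (fun _ => rfl) c).trans hc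
    · intro V _ V' _ h
      exact Subtype.ext (comap_equiv_injective _ (congrArg Subtype.val h))
  rw [mul_comm]
  symm
  refine ncard_eq_mul_of_fibres (fun V : Brauer q n => V.comp A) (fun _ _ => Set.mem_univ _) ?_
  intro W' _
  simpa using le_antisymm (hle W' W) (hle W W')

theorem ncard_fibre_mul_of_flip {B : Brauer r m} (hB : B.flip.IsFull) (T : Brauer r q) :
    {U : Brauer m q | B.comp U = T}.ncard * (Set.univ : Set (Brauer q r)).ncard =
      (Set.univ : Set (Brauer q m)).ncard := by
  rw [← hB.ncard_fibre_mul T.flip]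
  congr 1
  refine Set.ncard_congr (fun U _ => U.flip) ?_ ?_ ?_
  · rintro U rfl
    exact (flip_comp B U).symm
  · intro U U' _ _ h
    rw [← flip_flip U, h, flip_flip]
  · intro V hV
    refine ⟨V.flip, ?_, flip_flip V⟩
    have hV' : V.comp B.flip = T.flip := hV
    change B.comp V.flip = T
    rw [← flip_flip T, ← hV', flip_comp, flip_flip]

/-- Extending `t` trivially leaves the points of the range of `f` as singletons; `Sum.elim id f`
doubles exactly these, turning them into transversals. -/
theorem isBrauer_comap_map (f : Fin q ↪ Fin r) {t : Setoid {x // x ∉ Set.range f}}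
    (ht : IsBrauer t) :
    IsBrauer ((t.map Subtype.val).comap (Sum.elim id f : Fin r ⊕ Fin q → Fin r)) := by
  have hrel : ∀ u v : Fin r ⊕ Fin q, (t.map Subtype.val).comap (Sum.elim id f) u v ↔
      (∃ x y, t x y ∧ x.1 = Sum.elim id f u ∧ y.1 = Sum.elim id f v) ∨
        Sum.elim id f u = Sum.elim id f v :=
    fun u v => map_rel_iff Subtype.val_injective t _ _
  have hin : ∀ k u v, Sum.elim id f u = f k →
      ((t.map Subtype.val).comap (Sum.elim id f) u v ↔ v = Sum.inl (f k) ∨ v = Sum.inr k) := by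
    intro k u v hu
    rw [hrel, hu]
    constructor
    · rintro (⟨x, y, -, hx, -⟩ | h)
      · exact (x.2 ⟨k, hx.symm⟩).elim
      · rcases v with v | v
        · exact Or.inl (congrArg _ h.symm)
        · exact Or.inr (congrArg _ (f.injective h).symm)
    · rintro (rfl | rfl) <;> exact Or.inr rfl
  rw [isBrauer_iff_exists]
  rintro (x | k)
  · by_cases hx : x ∈ Set.range f
    · obtain ⟨k, rfl⟩ := hx
      exact ⟨Sum.inr k, by simp, fun z => hin k _ z rfl⟩
    · obtain ⟨y, hy, hxy⟩ := isBrauer_iff_exists.1 ht ⟨x, hx⟩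
      refine ⟨Sum.inl y.1, fun h => hy (Subtype.ext (by simpa using h)), fun z => ?_⟩
      rw [hrel]
      constructor
      · rintro (⟨x', y', h, hx', hy'⟩ | h)
        · have : x' = ⟨x, hx⟩ := Subtype.ext hx'
          subst this
          rcases z with z | z
          · have hy'' : y'.1 = z := hy'
            rcases (hxy _).1 h with h | h
            · exact Or.inl (by rw [← hy'', h])
            · exact Or.inr (by rw [← hy'', h])
          · exact (y'.2 ⟨z, hy'.symm⟩).elim
        · rcases z with z | z
          · exact Or.inl (congrArg _ h.symm)
          · exact (hx ⟨z, h.symm⟩).elim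
      · rintro (rfl | rfl)
        · exact Or.inr rfl
        · exact Or.inl ⟨⟨x, hx⟩, y, (hxy y).2 (Or.inr rfl), rfl, rfl⟩
  · refine ⟨Sum.inl (f k), by simp, fun z => ?_⟩
    rw [or_comm]
    exact hin k _ z rfl

/-- The partition of full rank with given transversals and hooks. -/
def ofEmbedding (p : (f : Fin q ↪ Fin r) × {t : Setoid {x // x ∉ Set.range f} // IsBrauer t}) :
    {T : Brauer r q // T.IsFull} :=
  ⟨⟨_, isBrauer_comap_map p.1 p.2.2⟩, fun k => ⟨p.1 k, Setoid.refl' (p.2.1.map _) _⟩⟩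

theorem ofEmbedding_bijective : Function.Bijective (ofEmbedding (q := q) (r := r)) := by
  constructor
  · rintro ⟨f, t⟩ ⟨f', t'⟩ h
    have hf : f = f' := by
      ext1 k
      have h1 : (ofEmbedding ⟨f, t⟩).1.1 (Sum.inl (f k)) (Sum.inr k) := Setoid.refl' (t.1.map _) _
      have h2 : (ofEmbedding ⟨f', t'⟩).1.1 (Sum.inl (f' k)) (Sum.inr k) :=
        Setoid.refl' (t'.1.map _) _
      rw [← h] at h2
      exact inl_eq_of_rel _ h1 h2
    subst hf
    have ht : ∀ s : {t : Setoid {x // x ∉ Set.range f} // IsBrauer t}, ∀ x y,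
        s.1 x y ↔ (ofEmbedding ⟨f, s⟩).1.1 (Sum.inl x.1) (Sum.inl y.1) := by
      intro s x y
      refine Iff.trans ?_ (map_rel_iff Subtype.val_injective s.1 x.1 y.1).symm
      constructor
      · exact fun h => Or.inl ⟨x, y, h, rfl, rfl⟩
      · rintro (⟨x', y', h, hx, hy⟩ | h)
        · rwa [← Subtype.ext hx, ← Subtype.ext hy]
        · rw [Subtype.ext h]
    congr 1
    refine Subtype.ext ?_
    ext x y
    rw [ht, ht, h]
  · rintro ⟨T, hT⟩
    have hT' := hT
    choose f hf using hT'
    have hinj : Function.Injective f := by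
      intro j j' h
      have h1 := hf j
      rw [h] at h1
      exact inr_eq_of_rel T h1 (hf j')
    let t : Setoid {x // x ∉ Set.range (⟨f, hinj⟩ : Fin q ↪ Fin r)} :=
      T.1.comap fun x => Sum.inl x.1
    have ht : IsBrauer t := by
      rw [isBrauer_iff_exists]
      intro x
      obtain ⟨y, hy, hxy⟩ := isBrauer_iff_exists.1 T.2 (Sum.inl x.1)
      have hxy' := (hxy y).2 (Or.inr rfl)
      rcases y with y | k
      · refine ⟨⟨y, ?_⟩, fun h => hy (by rw [← h]), fun z => ?_⟩
        · rintro ⟨k, rfl⟩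
          exact hy (congrArg _ (eq_of_rel_of_rel T (hf k) (Setoid.symm' _ hxy')).symm)
        · refine (hxy _).trans ?_
          simp [Subtype.ext_iff]
      · exact (x.2 ⟨k, inl_eq_of_rel T (hf k) hxy'⟩).elim
    refine ⟨⟨⟨f, hinj⟩, ⟨t, ht⟩⟩, Subtype.ext (Subtype.ext ?_)⟩
    have hp : ∀ u : Fin r ⊕ Fin q, T.1 u (Sum.inl (Sum.elim id f u)) := by
      rintro (u | u)
      · exact Setoid.refl' _ _
      · exact Setoid.symm' _ (hf u)
    have hpr : ∀ u v : Fin r ⊕ Fin q, T.1 u v ↔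
        T.1 (Sum.inl (Sum.elim id f u)) (Sum.inl (Sum.elim id f v)) := fun u v =>
      ⟨fun h => Setoid.trans' _ (Setoid.symm' _ (hp u)) (Setoid.trans' _ h (hp v)),
        fun h => Setoid.trans' _ (hp u) (Setoid.trans' _ h (Setoid.symm' _ (hp v)))⟩
    ext u v
    refine (map_rel_iff Subtype.val_injective t _ _).trans ?_
    rw [hpr]
    constructor
    · rintro (⟨x, y, h, hx, hy⟩ | h)
      · have h' : T.1 (Sum.inl x.1) (Sum.inl y.1) := h
        rw [hx, hy] at h'
        exact h'
      · have h' : Sum.elim id f u = Sum.elim id f v := h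
        rw [h']
    · intro h
      by_cases hu : Sum.elim id f u ∈ Set.range f
      · obtain ⟨k, hk⟩ := hu
        rw [← hk] at h
        exact Or.inr (hk.symm.trans (eq_of_rel_of_rel T (hf k) h).symm)
      by_cases hv : Sum.elim id f v ∈ Set.range f
      · obtain ⟨k, hk⟩ := hv
        rw [← hk] at h
        exact Or.inr ((eq_of_rel_of_rel T (hf k) (Setoid.symm' _ h)).trans hk)
      · exact Or.inl ⟨⟨_, hu⟩, ⟨_, hv⟩, h, rfl, rfl⟩

/-- There are `q! C(r,q)` embeddings choosing the upper ends of the transversals; each leaves `r -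
q` upper vertices to be matched among themselves. -/
theorem ncard_isFull (hq : q ≤ r) (h : Even (r - q)) :
    {T : Brauer r q | T.IsFull}.ncard =
      q.factorial * r.choose q * oddDoubleFactorial ((r : ℤ) - q - 1) := by
  classical
  have h1 := Nat.card_congr (Equiv.ofBijective _ (ofEmbedding_bijective (q := q) (r := r)))
  have h2 : ∀ f : Fin q ↪ Fin r, Nat.card {t : Setoid {x // x ∉ Set.range f} // IsBrauer t} =
      oddDoubleFactorial ((r : ℤ) - q - 1) := by
    intro f
    have hc : Fintype.card {x // x ∉ Set.range f} = r - q := by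
      rw [Fintype.card_subtype_compl, Fintype.card_fin]
      congr 1
      exact (Set.card_range_of_injective f.injective).trans (Fintype.card_fin q)
    have h3 := card_isBrauer (V := {x // x ∉ Set.range f}) (by rwa [hc])
    rw [hc, Nat.cast_sub hq] at h3
    exact h3
  rw [Nat.card_sigma] at h1
  simp only [h2, Finset.sum_const, Finset.card_univ, Fintype.card_embedding_eq, Fintype.card_fin,
    Nat.descFactorial_eq_factorial_mul_choose, smul_eq_mul] at h1
  exact h1.symm

end Brauer

theorem oddDoubleFactorial_pos {k : ℤ} (h : ¬ Even k) : 0 < oddDoubleFactorial k := by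
  rw [oddDoubleFactorial, if_neg h]
  exact Nat.doubleFactorial_pos _

namespace Brauer

variable {m n k q r : ℕ}

theorem ncard_univ_pos (h : Even (m + n)) : 0 < (Set.univ : Set (Brauer m n)).ncard := by
  rw [ncard_univ h]
  refine oddDoubleFactorial_pos ?_
  rw [Int.even_sub_one, not_not]
  exact_mod_cast h

theorem IsFull.exists_ncard_fibre {A : Brauer n r} (hA : A.IsFull) (h : Even (q + r)) :
    ∃ c, (∀ W : Brauer q r, {V : Brauer q n | V.comp A = W}.ncard = c) ∧
      c * (Set.univ : Set (Brauer q r)).ncard = (Set.univ : Set (Brauer q n)).ncard := by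
  have hc : ∀ W : Brauer q r, {V : Brauer q n | V.comp A = W}.ncard =
      (Set.univ : Set (Brauer q n)).ncard / (Set.univ : Set (Brauer q r)).ncard := fun W =>
    (Nat.div_eq_of_eq_mul_left (ncard_univ_pos h) (hA.ncard_fibre_mul W).symm).symm
  -- Some actual fibre is needed to see that the natural-number quotient is exact; parity makes the
  -- target nonempty.
  obtain ⟨W, -⟩ := Set.nonempty_of_ncard_ne_zero (ncard_univ_pos h).ne'
  exact ⟨_, hc, by rw [← hc W, hA.ncard_fibre_mul]⟩

theorem exists_ncard_fibre_of_flip {B : Brauer r m} (hB : B.flip.IsFull) (h : Even (q + r)) :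
    ∃ c, (∀ T : Brauer r q, {U : Brauer m q | B.comp U = T}.ncard = c) ∧
      c * (Set.univ : Set (Brauer q r)).ncard = (Set.univ : Set (Brauer q m)).ncard := by
  have hc : ∀ T : Brauer r q, {U : Brauer m q | B.comp U = T}.ncard =
      (Set.univ : Set (Brauer q m)).ncard / (Set.univ : Set (Brauer q r)).ncard := fun W =>
    (Nat.div_eq_of_eq_mul_left (ncard_univ_pos h) (ncard_fibre_mul_of_flip hB W).symm).symm
  obtain ⟨W, -⟩ := Set.nonempty_of_ncard_ne_zero (ncard_univ_pos h).ne'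
  exact ⟨_, hc, by rw [← hc W.flip, ncard_fibre_mul_of_flip hB]⟩

/-! ### Counting splittings by reduction to the identity. -/

/-- The pairs of partitions which split off the identity on `q` points from `σ`. -/
def splittings (σ : Brauer n m) (q : ℕ) : Set (Brauer q n × Brauer m q) :=
  {p | p.1.comp (σ.comp p.2) = one q}

theorem mem_splittings {σ : Brauer n m} {p : Brauer q n × Brauer m q} :
    p ∈ splittings σ q ↔ p.1.comp (σ.comp p.2) = one q :=
  Iff.rfl

theorem ncard_splittings_comp_left {A : Brauer n r} {B : Brauer r m} {c : ℕ}
    (hc : ∀ W : Brauer q r, {V : Brauer q n | V.comp A = W}.ncard = c) :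
    (splittings (A.comp B) q).ncard = (splittings B q).ncard * c := by
  refine ncard_eq_mul_of_fibres (fun p => (p.1.comp A, p.2)) ?_ ?_
  · intro p hp
    rw [mem_splittings, comp_assoc] at hp
    rw [mem_splittings, comp_assoc, hp]
  · rintro ⟨W, U⟩ hWU
    rw [← hc W]
    symm
    refine Set.ncard_congr (fun V _ => (V, U)) ?_ ?_ ?_
    · rintro V rfl
      refine ⟨?_, rfl⟩
      rw [mem_splittings, comp_assoc] at hWU ⊢
      exact hWU
    · intro V V' _ _ h
      exact (Prod.ext_iff.1 h).1
    · rintro ⟨V, U'⟩ ⟨-, h⟩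
      obtain ⟨h1, h2⟩ := Prod.ext_iff.1 h
      exact ⟨V, h1, Prod.ext rfl h2.symm⟩

theorem ncard_splittings_one_comp {B : Brauer r m} {c : ℕ}
    (hc : ∀ T : Brauer r q, {U : Brauer m q | B.comp U = T}.ncard = c) :
    (splittings B q).ncard = (splittings (one r) q).ncard * c := by
  refine ncard_eq_mul_of_fibres (fun p => (p.1, B.comp p.2)) ?_ ?_
  · intro p hp
    rw [mem_splittings, one_comp]
    exact hp
  · rintro ⟨W, T⟩ hWT
    rw [mem_splittings, one_comp] at hWT
    rw [← hc T]
    symm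
    refine Set.ncard_congr (fun U _ => (W, U)) ?_ ?_ ?_
    · rintro U rfl
      exact ⟨hWT, rfl⟩
    · intro V V' _ _ h
      exact (Prod.ext_iff.1 h).2
    · rintro ⟨V, U'⟩ ⟨-, h⟩
      obtain ⟨h1, h2⟩ := Prod.ext_iff.1 h
      exact ⟨U', h2, Prod.ext h1.symm rfl⟩

/-- In a pair `(W, T)` the partition `T` is forced to be full, and then `W` ranges over the fibre of
`W ↦ W T` above `one q`. -/
theorem ncard_splittings_one_mul (q r : ℕ) :
    (splittings (one r) q).ncard * (Set.univ : Set (Brauer q q)).ncard =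
      {T : Brauer r q | T.IsFull}.ncard * (Set.univ : Set (Brauer q r)).ncard := by
  have hq : Even (q + q) := ⟨q, rfl⟩
  have key : (splittings (one r) q).ncard = {T : Brauer r q | T.IsFull}.ncard *
      ((Set.univ : Set (Brauer q r)).ncard / (Set.univ : Set (Brauer q q)).ncard) := by
    refine ncard_eq_mul_of_fibres (fun p => p.2) ?_ ?_
    · intro p hp
      rw [mem_splittings, one_comp] at hp
      exact isFull_of_comp_eq_one hp
    · intro T hT
      rw [Nat.div_eq_of_eq_mul_left (ncard_univ_pos hq)
        (IsFull.ncard_fibre_mul hT (one q)).symm]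
      symm
      refine Set.ncard_congr (fun W _ => (W, T)) ?_ ?_ ?_
      · intro W hW
        refine ⟨?_, rfl⟩
        rw [mem_splittings, one_comp]
        exact hW
      · intro V V' _ _ h
        exact (Prod.ext_iff.1 h).1
      · rintro ⟨W, T'⟩ ⟨h1, rfl⟩
        rw [mem_splittings, one_comp] at h1
        exact ⟨W, h1, rfl⟩
  rw [key, mul_assoc]
  -- Without full partitions both sides vanish; otherwise the fibre law for one of them shows that
  -- the quotient is exact.
  rcases Set.eq_empty_or_nonempty {T : Brauer r q | T.IsFull} with h0 | ⟨T, hT⟩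
  · simp [h0]
  · rw [Nat.div_mul_cancel]
    exact ⟨_, by rw [mul_comm, IsFull.ncard_fibre_mul hT (one q)]⟩

/-! ### From splittings to idempotents. -/

/-- The idempotents of rank `q` of the sandwich semigroup of `σ`. -/
def idempotents (σ : Brauer n m) (q : ℕ) : Set (Brauer m n) :=
  {α | (α.comp σ).comp α = α ∧ rank α.1 = q}

theorem comp_mem_idempotents {σ : Brauer n m} {V : Brauer q n} {U : Brauer m q}
    (h : V.comp (σ.comp U) = one q) : U.comp V ∈ idempotents σ q := by
  constructor
  · calc ((U.comp V).comp σ).comp (U.comp V)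
        = (U.comp (V.comp (σ.comp U))).comp V := by simp only [comp_assoc]
      _ = U.comp V := by rw [h, comp_one]
  · refine rank_comp_of_isFull ?_ ?_
    · rw [← comp_assoc] at h
      exact isFull_of_comp_eq_one h
    · have h' := congrArg flip h
      rw [flip_comp, flip_one] at h'
      exact isFull_of_comp_eq_one h'

theorem exists_splitting {σ : Brauer n m} {α : Brauer m n} (hα : α ∈ idempotents σ q) :
    ∃ (V : Brauer q n) (U : Brauer m q), V.comp (σ.comp U) = one q ∧ U.comp V = α := by
  obtain ⟨hi, rfl⟩ := hα
  obtain ⟨U, V, hU, hV, h⟩ := exists_eq_comp α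
  refine ⟨V, U, ?_, h⟩
  have hV' := hV.flip_comp_self
  rw [flip_flip] at hV'
  calc V.comp (σ.comp U)
      = (U.flip.comp U).comp (V.comp (σ.comp (U.comp (V.comp V.flip)))) := by
        rw [hU.flip_comp_self, hV', comp_one, one_comp]
    _ = U.flip.comp ((((U.comp V).comp σ).comp (U.comp V)).comp V.flip) := by
        simp only [comp_assoc]
    _ = U.flip.comp ((U.comp V).comp V.flip) := by
        rw [h, hi]
    _ = one _ := by
        rw [comp_assoc, hV', comp_one, hU.flip_comp_self]

/-- Fix one pair `(V₀, U₀)` over `α`. Any other pair `(V, U)` determines the permutation `P = V₀ σ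
U`, with inverse `V σ U₀`, and is recovered as `U = U₀ P`, `V = P.flip V₀`. Thus permutations act
simply transitively on the fibre. -/
theorem ncard_splittings_fibre {σ : Brauer n m} {α : Brauer m n} (hα : α ∈ idempotents σ q) :
    {p ∈ splittings σ q | p.2.comp p.1 = α}.ncard = {P : Brauer q q | P.IsFull}.ncard := by
  obtain ⟨V₀, U₀, h₀, hα₀⟩ := exists_splitting hα
  have hinv : ∀ (V : Brauer q n) (U : Brauer m q), V.comp (σ.comp U) = one q → U.comp V = α →
      (V.comp (σ.comp U₀)).comp (V₀.comp (σ.comp U)) = one q := by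
    intro V U h1 h2
    calc (V.comp (σ.comp U₀)).comp (V₀.comp (σ.comp U))
        = V.comp (σ.comp ((U₀.comp V₀).comp (σ.comp U))) := by simp only [comp_assoc]
      _ = (V.comp (σ.comp U)).comp (V.comp (σ.comp U)) := by
        rw [hα₀, ← h2]
        simp only [comp_assoc]
      _ = one q := by rw [h1, comp_one]
  have hU : ∀ (V : Brauer q n) (U : Brauer m q), V.comp (σ.comp U) = one q → U.comp V = α →
      U₀.comp (V₀.comp (σ.comp U)) = U := by
    intro V U h1 h2
    rw [← comp_assoc, hα₀, ← h2, comp_assoc, h1, comp_one]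
  have hV : ∀ (V : Brauer q n) (U : Brauer m q), V.comp (σ.comp U) = one q → U.comp V = α →
      (V₀.comp (σ.comp U)).flip.comp V₀ = V := by
    intro V U h1 h2
    have hQ := hinv V U h1 h2
    have hP := (isFull_of_comp_eq_one hQ).comp_flip_self
    have hQP : V.comp (σ.comp U₀) = (V₀.comp (σ.comp U)).flip := by
      rw [← comp_one (V.comp (σ.comp U₀)), ← hP, ← comp_assoc, hQ, one_comp]
    rw [← hQP, comp_assoc, comp_assoc, hα₀, ← h2, ← comp_assoc σ, ← comp_assoc V, h1, one_comp]
  refine Set.ncard_congr (fun p _ => V₀.comp (σ.comp p.2)) ?_ ?_ ?_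
  · rintro ⟨V, U⟩ ⟨h1, h2⟩
    exact isFull_of_comp_eq_one (hinv V U h1 h2)
  · rintro ⟨V, U⟩ ⟨V', U'⟩ ⟨h1, h2⟩ ⟨h1', h2'⟩ h
    replace h : V₀.comp (σ.comp U) = V₀.comp (σ.comp U') := h
    refine Prod.ext ?_ ?_
    · change V = V'
      rw [← hV V U h1 h2, h, hV V' U' h1' h2']
    · change U = U'
      rw [← hU V U h1 h2, h, hU V' U' h1' h2']
  · intro P hP
    have hP1 : P.flip.comp P = one q := IsFull.flip_comp_self hP
    have hP2 : P.comp P.flip = one q := IsFull.comp_flip_self hP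
    refine ⟨(P.flip.comp V₀, U₀.comp P), ⟨?_, ?_⟩, ?_⟩
    · change (P.flip.comp V₀).comp (σ.comp (U₀.comp P)) = one q
      calc (P.flip.comp V₀).comp (σ.comp (U₀.comp P))
          = P.flip.comp ((V₀.comp (σ.comp U₀)).comp P) := by simp only [comp_assoc]
        _ = one q := by rw [h₀, one_comp, hP1]
    · change (U₀.comp P).comp (P.flip.comp V₀) = α
      rw [comp_assoc, ← comp_assoc P, hP2, one_comp, hα₀]
    · change V₀.comp (σ.comp (U₀.comp P)) = P
      rw [← comp_assoc σ, ← comp_assoc V₀, h₀, one_comp]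

theorem ncard_splittings (σ : Brauer n m) (q : ℕ) :
    (splittings σ q).ncard = (idempotents σ q).ncard * q.factorial := by
  refine ncard_eq_mul_of_fibres (fun p => p.2.comp p.1)
    (fun p hp => comp_mem_idempotents (mem_splittings.1 hp)) ?_
  intro α hα
  -- The case `r = q` of the count of full partitions: the remaining factor is `(-1)!! = 1`, leaving
  -- `q!`.
  rw [ncard_splittings_fibre hα, ncard_isFull le_rfl (by simp)]
  simp [oddDoubleFactorial]

theorem ncard_idempotents (σ : Brauer n m) (hq : q ≤ rank σ.1) (h : q ≡ rank σ.1 [MOD 2]) :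
    ((idempotents σ q).ncard : ℚ) = idempotentTerm m n (rank σ.1) q := by
  obtain ⟨A, B, hA, hB, hAB⟩ := exists_eq_comp σ
  generalize rank σ.1 = r at *
  have hqr : Even (q + r) := by
    rw [Nat.even_add, Nat.even_iff, Nat.even_iff, h]
  have hqm : Even (q + m) := by
    have := B.even_add
    rw [Nat.even_add] at hqr this ⊢
    tauto
  have hqn : Even (q + n) := by
    have := A.even_add
    rw [Nat.even_add] at hqr this ⊢
    tauto
  obtain ⟨c₁, h₁, h₁'⟩ := hA.exists_ncard_fibre hqr
  obtain ⟨c₂, h₂, h₂'⟩ := exists_ncard_fibre_of_flip hB hqr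
  have h₃ := ncard_splittings_one_mul q r
  have hN := ncard_splittings σ q
  rw [← hAB, ncard_splittings_comp_left h₁, ncard_splittings_one_comp h₂, hAB] at hN
  have hsub : Even (r - q) := by
    rw [Nat.even_sub hq, Nat.even_iff, Nat.even_iff, h]
  have p₁ := ncard_univ_pos hqr
  have p₂ := ncard_univ_pos (⟨q, rfl⟩ : Even (q + q))
  rw [ncard_isFull hq hsub] at h₃
  rw [ncard_univ hqr] at h₁' h₂' h₃ p₁
  rw [ncard_univ hqn] at h₁'
  rw [ncard_univ hqm] at h₂'
  rw [ncard_univ ⟨q, rfl⟩] at h₃ p₂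
  have e₁ : (m : ℤ) + q - 1 = q + m - 1 := by ring
  have e₂ : (n : ℤ) + q - 1 = q + n - 1 := by ring
  have e₃ : (r : ℤ) + q - 1 = q + r - 1 := by ring
  have e₄ : 2 * (q : ℤ) - 1 = q + q - 1 := by ring
  rw [idempotentTerm, e₁, e₂, e₃, e₄, ← h₁', ← h₂', eq_div_iff (by positivity)]
  have hf : (q.factorial : ℚ) ≠ 0 := by positivity
  refine mul_right_cancel₀ hf ?_
  have hN' : (((splittings (one r) q).ncard * c₂ * c₁ : ℕ) : ℚ) =
      ((idempotents σ q).ncard * q.factorial : ℕ) := congrArg _ hN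
  have h₃' := congrArg (Nat.cast : ℕ → ℚ) h₃
  push_cast at hN' h₃' ⊢
  -- The coefficients are chosen to eliminate the number of splittings of `one r` between the two
  -- equations.
  linear_combination (-(oddDoubleFactorial ((q : ℤ) + r - 1) *
    oddDoubleFactorial ((q : ℤ) + q - 1) : ℚ)) * hN' +
    (c₁ * c₂ * oddDoubleFactorial ((q : ℤ) + r - 1) : ℚ) * h₃'

theorem rank_of_idempotent {σ : Brauer n m} {α : Brauer m n} (h : (α.comp σ).comp α = α) :
    rank α.1 ≤ rank σ.1 ∧ rank α.1 ≡ rank σ.1 [MOD 2] := by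
  constructor
  · calc rank α.1 = rank ((α.comp σ).comp α).1 := by rw [h]
      _ ≤ rank (α.comp σ).1 := rank_comp_le_left _ _
      _ ≤ rank σ.1 := rank_comp_le_right _ _
  -- Only the existence of the factors is used: `U` and `B` show that both ranks have the parity of
  -- `m`.
  · obtain ⟨U, -⟩ := exists_eq_comp α
    obtain ⟨-, B, -⟩ := exists_eq_comp σ
    have h1 := U.even_add
    have h2 := B.even_add
    rw [Nat.even_iff] at h1 h2
    rw [Nat.ModEq]
    omega

end Brauer

end Diagram

/-! ### The theorem: summation over ranks. -/

theorem mainTheorem5 (m n : ℕ) (σ : Diagram.Brauer n m) (r : ℕ) (hr : r = Diagram.rank σ.1) :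
    (({α : Diagram.Sandwich σ | IsIdempotentElem α}.ncard : ℚ) =
        ∑ q ∈ (Finset.range (r + 1)).filter (fun q => q ≡ r [MOD 2]),
          Diagram.idempotentTerm m n r q) ∧
      ∀ q : ℕ, q ≤ r → q ≡ r [MOD 2] →
        ({α : Diagram.Sandwich σ | IsIdempotentElem α ∧ α ∈ Diagram.regularRank σ q}.ncard : ℚ) =
          Diagram.idempotentTerm m n r q := by
  subst hr
  constructor
  · classical
    let S : Set (Diagram.Brauer m n) := {α | (α.comp σ).comp α = α}
    change (S.ncard : ℚ) = _
    cases nonempty_fintype (Diagram.Brauer m n)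
    have hmaps : Set.MapsTo (fun α : Diagram.Brauer m n => Diagram.rank α.1) S.toFinset
        ((Finset.range (Diagram.rank σ.1 + 1)).filter
          (fun q => q ≡ Diagram.rank σ.1 [MOD 2]) : Finset ℕ) := by
      intro α hα
      have hα' : (α.comp σ).comp α = α := by simpa [S] using hα
      have h := Diagram.Brauer.rank_of_idempotent hα'
      simpa [Nat.lt_succ_iff] using h
    rw [Set.ncard_eq_toFinset_card', Finset.card_eq_sum_card_fiberwise hmaps, Nat.cast_sum]
    refine Finset.sum_congr rfl fun q hq => ?_
    rw [Finset.mem_filter, Finset.mem_range, Nat.lt_succ_iff] at hq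
    rw [← Diagram.Brauer.ncard_idempotents σ hq.1 hq.2, ← Set.ncard_coe_finset]
    congr 2
    ext α
    simp [S, Diagram.Brauer.idempotents]
  · intro q hq h
    rw [← Diagram.Brauer.ncard_idempotents σ hq h]
    congr 2
    ext α
    constructor
    · rintro ⟨h1, -, h2⟩
      exact ⟨h1, h2⟩
    · rintro ⟨h1, h2⟩
      have h1' : α * α = α := h1
      -- An idempotent is regular with itself as the middle factor, so the regularity condition
      -- costs nothing.
      exact ⟨h1, ⟨α, by rw [h1', h1']⟩, h2⟩
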